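/- Let $V\in C^\infty(\mathbb R)$ be even with $V'(u)=u\pm u^3+\mathcal O(u^5)$ as $u\to0$ (for one of the two signs). For an energy level $E'>V(0)$ let $a(E')$ be the smallest positive root of $V(a)=E'$, and let $$T(E')=\sqrt2\int_{-a(E')}^{a(E')}\frac{dx}{\sqrt{E'-V(x)}} .$$ Fix $E>V(0)$ for which $a:=a(E)$ exists and $T:=T(E)$ is finite, and let $\varphi\in H^2_e(0,T)$ be the even $T$-periodic solution of $\ddot\varphi+V'(\varphi)=0$, $\varphi(0)=a$, $\dot\varphi(0)=0$. Here $H^2_e(0,T)$ is the space of even real $T$-periodic functions $f(t)=\sum_{m\in\mathbb Z}c_me^{2\pi imt/T}$ with finite norm $\|f\|_{H^2_{\rm per}(0,T)}=\big(\sum_{m\in\mathbb Z}(1+m^2)^2|c_m|^2\big)^{1/2}$, and $l^2(\mathbb Z,H^2_e(0,T))$ has the norm $\|{\bf u}\|=\big(\sum_{n\in\mathbb Z}\|u_n\|^2_{H^2_{\rm per}(0,T)}\big)^{1/2}$. Assume $$T\neq2\pi n\ \text{ for all } n\in\mathbb N,\qquad T'(E)\neq0 .$$ Let $S\subset\mathbb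 Z$ be finite, let $\sigma_k\in\{+1,-1\}$ for $k\in S$, and let ${\bf u}^{(0)}=\sum_{k\in S}\sigma_k\varphi\,{\bf e}_k$, where ${\bf e}_k$ is the $k$-th unit vector of $l^2(\mathbb Z)$. Then there are $\epsilon_0>0$ and $C>0$ such that for every $\epsilon\in(-\epsilon_0,\epsilon_0)$ there exists a unique solution ${\bf u}^{(\epsilon)}\in l^2(\mathbb Z,H^2_e(0,T))$ of the discrete Klein--Gordon equation $$\ddot u_n+V'(u_n)=\epsilon(u_{n+1}-2u_n+u_{n-1}),\qquad n\in\mathbb Z,$$ satisfying $$\|{\bf u}^{(\epsilon)}-{\bf u}^{(0)}\|_{l^2(\mathbb Z,H^2_{\rm per}(0,T))}\le C|\epsilon| .$$ Moreover, the map $\epsilon\mapsto{\bf u}^{(\epsilon)}\in l^2(\mathbb Z,H^2_e(0,T))$ is $C^\infty$ on $(-\epsilon_0,\epsilon_0)$. -/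

import Mathlib

open Set Filter Topology MeasureTheory
open scoped ContDiff

noncomputable section

namespace KG

/-- The Fourier coefficient `c_m = T⁻¹ ∫_0^T f(t) exp(-2πimt/T) dt`, so that
`f(t) = ∑ m, c_m exp(2πimt/T)` for a `T`-periodic function `f`. -/
def fourierC (T : ℝ) (f : ℝ → ℝ) (m : ℤ) : ℂ :=
  (1 / T : ℂ) * ∫ t in (0 : ℝ)..T,
    Complex.exp (-(2 * Real.pi * Complex.I * m * t / T)) * (f t : ℂ)

/-- The sequence `(1 + m²) c_m`, whose `ℓ²` norm is the `H²_per(0,T)` norm of `f`. -/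
def weightedC (T : ℝ) (f : ℝ → ℝ) (m : ℤ) : ℂ :=
  ((1 + (m : ℝ) ^ 2 : ℝ) : ℂ) * fourierC T f m

theorem weightedC_add (T : ℝ) {f g : ℝ → ℝ} (hf : Continuous f) (hg : Continuous g) :
    weightedC T (f + g) = weightedC T f + weightedC T g := by
  funext m
  have h : ∀ {k : ℝ → ℝ}, Continuous k → IntervalIntegrable (fun t : ℝ =>
      Complex.exp (-(2 * Real.pi * Complex.I * m * t / T)) * (k t : ℂ)) volume 0 T := by
    intro k hk
    apply Continuous.intervalIntegrable
    fun_prop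
  simp only [weightedC, fourierC, Pi.add_apply, Complex.ofReal_add, mul_add]
  rw [intervalIntegral.integral_add (h hf) (h hg)]
  ring

theorem weightedC_smul (T : ℝ) (c : ℝ) (f : ℝ → ℝ) :
    weightedC T (c • f) = c • weightedC T f := by
  funext m
  have h : (fun t : ℝ => Complex.exp (-(2 * Real.pi * Complex.I * m * t / T)) *
        (((c • f) t : ℝ) : ℂ))
      = fun t : ℝ => (c : ℂ) *
        (Complex.exp (-(2 * Real.pi * Complex.I * m * t / T)) * (f t : ℂ)) := by
    funext t
    simp only [Pi.smul_apply, smul_eq_mul, Complex.ofReal_mul]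
    ring
  simp only [weightedC, fourierC, Pi.smul_apply, Complex.real_smul] at h ⊢
  rw [h, intervalIntegral.integral_const_mul]
  ring

/-- The space `H²_e(0,T)` as a subspace of the real functions on `ℝ`: the even `T`-periodic
functions whose Fourier coefficients satisfy `∑ m, (1 + m²)² |c_m|² < ∞`. Every class in this
Sobolev space has exactly one continuous representative, and this representative is taken. -/
def evenH2 (T : ℝ) : Submodule ℝ (ℝ → ℝ) where
  carrier := {f | Continuous f ∧ Function.Periodic f T ∧ (∀ t, f (-t) = f t) ∧
    Memℓp (weightedC T f) 2}
  zero_mem' := by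
    refine ⟨continuous_const, fun t => rfl, fun t => rfl, ?_⟩
    have : weightedC T (0 : ℝ → ℝ) = 0 := by
      simpa using weightedC_smul T 0 (0 : ℝ → ℝ)
    rw [this]
    exact zero_memℓp
  add_mem' := by
    rintro f g ⟨hf, hfp, hfe, hfm⟩ ⟨hg, hgp, hge, hgm⟩
    refine ⟨hf.add hg, hfp.add hgp, fun t => by simp [hfe t, hge t], ?_⟩
    rw [weightedC_add T hf hg]
    exact hfm.add hgm
  smul_mem' := by
    rintro c f ⟨hf, hfp, hfe, hfm⟩
    refine ⟨hf.const_smul c, fun t => by simp [hfp t], fun t => by simp [hfe t], ?_⟩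
    rw [weightedC_smul T c f]
    exact hfm.const_smul c

/-- The space `H²_e(0,T)`, a type of its own, so that it carries the Sobolev norm and not the
topology of pointwise convergence. -/
def H2e (T : ℝ) : Type := evenH2 T

instance (T : ℝ) : AddCommGroup (H2e T) := inferInstanceAs (AddCommGroup (evenH2 T))

instance (T : ℝ) : Module ℝ (H2e T) := inferInstanceAs (Module ℝ (evenH2 T))

instance (T : ℝ) : CoeFun (H2e T) (fun _ => ℝ → ℝ) := ⟨fun f => f.1⟩

/-- The linear map `f ↦ ((1 + m²) c_m)_m` from `H²_e(0,T)` to `ℓ²(ℤ, ℂ)`. -/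
def toSeq (T : ℝ) : H2e T →ₗ[ℝ] lp (fun _ : ℤ => ℂ) 2 where
  toFun f := ⟨weightedC T f, f.2.2.2.2⟩
  map_add' f g := Subtype.ext (weightedC_add T f.2.1 g.2.1)
  map_smul' c f := Subtype.ext (weightedC_smul T c f.1)

theorem toSeq_injective (T : ℝ) [hT : Fact (0 < T)] : Function.Injective (toSeq T) := by
  rw [injective_iff_map_eq_zero]
  intro f hf
  obtain ⟨f, hfc, hfp, hfe, hfm⟩ := f
  have hc : ∀ m : ℤ, fourierC T f m = 0 := by
    intro m
    have h1 : weightedC T f m = 0 := congrFun (congrArg Subtype.val hf) m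
    rcases mul_eq_zero.1 h1 with h2 | h2
    · exfalso
      have : (0 : ℝ) < 1 + (m : ℝ) ^ 2 := by positivity
      exact this.ne' (by exact_mod_cast h2)
    · exact h2
  have hgp : Function.Periodic (fun t => (f t : ℂ)) T := fun t => by simp [hfp t]
  have hgc : Continuous (hgp.lift : AddCircle T → ℂ) :=
    (show Continuous (fun t => (f t : ℂ)) by fun_prop).quotient_lift _
  let g : C(AddCircle T, ℂ) := ⟨hgp.lift, hgc⟩
  have hg0 : ∀ m : ℤ, fourierCoeff (g : AddCircle T → ℂ) m = 0 := by
    intro m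
    rw [fourierCoeff_eq_intervalIntegral _ m 0]
    have := hc m
    unfold fourierC at this
    rw [← this, zero_add, Complex.real_smul]
    push_cast
    congr 1
    apply intervalIntegral.integral_congr
    intro t _
    have hgt : g (t : AddCircle T) = (f t : ℂ) := rfl
    beta_reduce
    rw [hgt, smul_eq_mul, fourier_coe_apply]
    congr 2
    push_cast
    ring
  have hs := hasSum_fourier_series_of_summable (f := g) (by
    rw [show fourierCoeff (g : AddCircle T → ℂ) = 0 from funext hg0]; exact summable_zero)
  simp only [hg0, zero_smul] at hs
  have hz : g = 0 := hs.unique hasSum_zero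
  apply Subtype.ext
  funext t
  have : g (t : AddCircle T) = 0 := by rw [hz]; rfl
  have h2 : (f t : ℂ) = 0 := this
  exact_mod_cast h2

/-- The norm of `H²_per(0,T)`, namely `‖f‖ = (∑ m, (1 + m²)² |c_m|²)^(1/2)`. -/
instance (T : ℝ) [Fact (0 < T)] : NormedAddCommGroup (H2e T) :=
  NormedAddCommGroup.induced (H2e T) (lp (fun _ : ℤ => ℂ) 2) (toSeq T) (toSeq_injective T)

theorem norm_eq (T : ℝ) [Fact (0 < T)] (f : H2e T) :
    ‖f‖ = Real.sqrt (∑' m : ℤ, (1 + (m : ℝ) ^ 2) ^ 2 * ‖fourierC T f m‖ ^ 2) := by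
  have h : ‖f‖ = ‖toSeq T f‖ := rfl
  rw [h, lp.norm_eq_tsum_rpow (by norm_num), Real.sqrt_eq_rpow]
  have h2 : ∀ m : ℤ, (1 + (m : ℝ) ^ 2) ^ 2 * ‖fourierC T f m‖ ^ 2
      = ‖(toSeq T f : ℤ → ℂ) m‖ ^ (2 : ENNReal).toReal := by
    intro m
    have hp : (0 : ℝ) ≤ 1 + (m : ℝ) ^ 2 := by positivity
    have h3 : (toSeq T f : ℤ → ℂ) m = weightedC T f m := rfl
    rw [h3, weightedC, norm_mul, Complex.norm_real, Real.norm_of_nonneg hp]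
    simp [mul_pow]
  simp only [h2]
  norm_num

instance (T : ℝ) [Fact (0 < T)] : NormedSpace ℝ (H2e T) where
  norm_smul_le c f := by
    have h : ‖c • f‖ = ‖toSeq T (c • f)‖ := rfl
    rw [h, map_smul]
    exact norm_smul_le c (toSeq T f)

/-- The space `l²(ℤ, H²_e(0,T))`. -/
abbrev LatticeH2e (T : ℝ) [Fact (0 < T)] : Type := lp (fun _ : ℤ => H2e T) 2

/-- `u` is a (classical) solution of the discrete Klein--Gordon equation
`u_n'' + V'(u_n) = ε (u_{n+1} - 2 u_n + u_{n-1})`, `n ∈ ℤ`. -/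
def IsKGSolution (V : ℝ → ℝ) (ε : ℝ) (u : ℤ → ℝ → ℝ) : Prop :=
  ∀ n : ℤ, Differentiable ℝ (u n) ∧ ∀ t : ℝ,
    DifferentiableAt ℝ (deriv (u n)) t ∧
    deriv (deriv (u n)) t + deriv V (u n t) = ε * (u (n + 1) t - 2 * u n t + u (n - 1) t)

/-- `φ` is a (classical) solution of the nonlinear oscillator equation `φ'' + V'(φ) = 0`. -/
def IsOscillatorSolution (V : ℝ → ℝ) (φ : ℝ → ℝ) : Prop :=
  Differentiable ℝ φ ∧ ∀ t : ℝ,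
    DifferentiableAt ℝ (deriv φ) t ∧ deriv (deriv φ) t + deriv V (φ t) = 0

/-- The amplitude `a(E)`: the smallest positive root of `V(a) = E`. -/
def amplitude (V : ℝ → ℝ) (E : ℝ) : ℝ := sInf {x : ℝ | 0 < x ∧ V x = E}

/-- The period `T(E) = √2 ∫_{-a(E)}^{a(E)} dx / √(E - V(x))` of the oscillations of energy `E`. -/
def period (V : ℝ → ℝ) (E : ℝ) : ℝ :=
  Real.sqrt 2 * ∫ x in (-amplitude V E)..(amplitude V E), 1 / Real.sqrt (E - V x)

/-- The limiting configuration `∑ k ∈ S, σ_k φ e_k`. -/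
def limitingBreather {T : ℝ} [Fact (0 < T)] (S : Finset ℤ) (σ : ℤ → ℝ) (φ : H2e T) :
    LatticeH2e T :=
  ∑ k ∈ S, lp.single 2 k (σ k • φ)

end KG

end

/-!
The equation is rewritten as a fixed point problem. With `p x = x - V' x`, a function `v` solves
`v'' + V'(v) = h` exactly when `v'' + v = p(v) + h`. Since `T` is not a multiple of `2π`, the
operator `v'' + v` on even `T`-periodic functions has an inverse, given by variation of parameters
(`solOp`, `eq_solOp_iff`). It maps continuous functions to `H²_e(0,T)`, because the Fourier
multiplier `(1 + m²) / (1 - (2πm/T)²)` is bounded. A solution of the lattice equation in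
`ℓ²(ℤ, H²_e)` is therefore the same as a zero of
`F(ε, w) = w - A (P w + ε Δ w)` on `ℓ²(ℤ, C(AddCircle T, ℝ))`, where `A` applies the inverse site by
site and `P` is superposition with `p` (`isKGSolution_iff`). On this space `P` is smooth: by
Hadamard's lemma `p x = g(x) x`, and superposition with `g` is smooth on bounded continuous
functions (`exists_contDiff_lattice_superpose`). The solution `u ε` in `ℓ²(ℤ, H²_e)` is recovered by
applying the inverse once more, so completeness of `H²_e` plays no role.

The implicit function theorem (`exists_smooth_branch`) needs `∂F/∂w` at the limiting configuration
to be invertible. This operator acts site by site. On an unexcited site it is the identity, because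
`p'(0) = 1 - V''(0) = 0`. On an excited site it is `1 - A ∘ (p'(φ) ·)`, where `A` is compact by
Arzelà-Ascoli, so by the Fredholm alternative it is enough that the linearised equation
`w'' + V''(φ) w = 0` has no even `T`-periodic solution `w ≠ 0` (`isUnit_linearization`).

That is where `T'(E) ≠ 0` enters (`linearized_solution_eq_zero`). If such a `w` exists, normalise it
by `w 0 = 1`; the Wronskian of `w` and `φ'` gives `w (T/2) = -1`. The curve `X = φ + η w` then runs
monotonically from `a + η` to `-(a + η)` during the half period, and its energy differs from
`V (a + η)` by at most a constant times `η² X'²`. Substituting `x = X t` in the integral for the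
period at energy `V (a + η)` gives `T + O(η²)` (`period_perturbation`), whence `T'(E) V'(a) = 0`.
But `V'(a) > 0`, because otherwise the integral for `T(E)` would diverge (`deriv_potential_pos`).
-/

noncomputable section

namespace KG

/-! ### Calculus on the line -/

/-- Second-order Taylor estimate, uniform on a bounded interval. -/
theorem exists_taylor_bound {f : ℝ → ℝ} (hf : ContDiff ℝ 2 f) (R : ℝ) :
    ∃ C > 0, ∀ x ∈ Icc (-R) R, ∀ y ∈ Icc (-R) R,
      |f y - f x - deriv f x * (y - x)| ≤ C * (y - x) ^ 2 := by
  have hd : Differentiable ℝ f := hf.differentiable (by norm_num)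
  have hf1 : ContDiff ℝ 1 (deriv f) := by
    have : ContDiff ℝ (1 + 1) f := by norm_num; exact hf
    exact (contDiff_succ_iff_deriv.1 this).2.2
  have hd1 : Differentiable ℝ (deriv f) := hf1.differentiable (by norm_num)
  have hc : Continuous (deriv (deriv f)) := hf1.continuous_deriv le_rfl
  obtain ⟨C, hC⟩ := isCompact_Icc.exists_bound_of_continuousOn
    (hc.continuousOn (s := Icc (-R) R))
  refine ⟨|C| + 1, by positivity, fun x hx y hy => ?_⟩
  have hsub : uIcc x y ⊆ Icc (-R) R := by
    intro z hz
    rw [mem_uIcc] at hz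
    rcases hz with hz | hz
    · exact ⟨hx.1.trans hz.1, hz.2.trans hy.2⟩
    · exact ⟨hy.1.trans hz.1, hz.2.trans hx.2⟩
  have hlip : ∀ z ∈ uIcc x y, ‖deriv f z - deriv f x‖ ≤ (|C| + 1) * |y - x| := by
    intro z hz
    have h1 := (convex_uIcc x y).norm_image_sub_le_of_norm_hasDerivWithin_le
      (f := deriv f) (f' := deriv (deriv f)) (C := |C| + 1)
      (fun u _ => (hd1 u).hasDerivAt.hasDerivWithinAt)
      (fun u hu => (hC u (hsub hu)).trans (by linarith [le_abs_self C])) left_mem_uIcc hz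
    refine h1.trans ?_
    gcongr
    exact abs_sub_left_of_mem_uIcc hz
  have h2 := (convex_uIcc x y).norm_image_sub_le_of_norm_hasDerivWithin_le
    (f := fun z => f z - deriv f x * z) (f' := fun z => deriv f z - deriv f x)
    (C := (|C| + 1) * |y - x|)
    (fun u _ => ((hd u).hasDerivAt.sub (by
      simpa using (hasDerivAt_id u).const_mul (deriv f x))).hasDerivWithinAt)
    hlip left_mem_uIcc right_mem_uIcc
  rw [Real.norm_eq_abs, Real.norm_eq_abs] at h2
  calc _ = |f y - deriv f x * y - (f x - deriv f x * x)| := by congr 1; ring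
    _ ≤ _ := h2
    _ = _ := by rw [mul_assoc, ← pow_two, sq_abs]

/-- A solution of `w'' = - q w` with bounded `q` and vanishing data at `0` vanishes. -/
theorem linear_ode_eq_zero {w w' q : ℝ → ℝ} {K : ℝ} (hq : ∀ t, |q t| ≤ K)
    (hw : ∀ t, HasDerivAt w (w' t) t) (hw' : ∀ t, HasDerivAt w' (-(q t) * w t) t)
    (h0 : w 0 = 0) (h0' : w' 0 = 0) (t : ℝ) : w t = 0 := by
  have hK : 0 ≤ K := (abs_nonneg _).trans (hq 0)
  have key := ODE_solution_unique_univ (E := ℝ × ℝ)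
    (v := fun t z => (z.2, -(q t) * z.1)) (s := fun _ => univ)
    (K := Real.toNNReal (max 1 K))
    (f := fun t => (w t, w' t)) (g := fun _ => (0, 0)) (t₀ := 0) ?_ ?_ ?_ ?_
  · exact congrArg Prod.fst (congrFun key t)
  · intro t
    rw [lipschitzOnWith_univ]
    refine LipschitzWith.of_dist_le_mul fun x y => ?_
    rw [Prod.dist_eq, Prod.dist_eq]
    rw [Real.coe_toNNReal _ (le_max_of_le_left zero_le_one)]
    simp only [Real.dist_eq]
    have h1 : |x.1 - y.1| ≤ max |x.1 - y.1| |x.2 - y.2| := le_max_left _ _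
    have h2 : |x.2 - y.2| ≤ max |x.1 - y.1| |x.2 - y.2| := le_max_right _ _
    have hm : 0 ≤ max |x.1 - y.1| |x.2 - y.2| := (abs_nonneg _).trans h1
    apply max_le
    · calc |x.2 - y.2| ≤ 1 * max |x.1 - y.1| |x.2 - y.2| := by simp
        _ ≤ _ := mul_le_mul_of_nonneg_right (le_max_left _ _) hm
    · calc |-(q t) * x.1 - -(q t) * y.1| = |q t| * |x.1 - y.1| := by
            rw [← mul_sub, abs_mul, abs_neg]
        _ ≤ max 1 K * max |x.1 - y.1| |x.2 - y.2| := by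
            gcongr
            exact (hq t).trans (le_max_right _ _)
  · exact fun t => ⟨(hw t).prodMk (hw' t), mem_univ _⟩
  · intro t
    refine ⟨?_, mem_univ _⟩
    convert! hasDerivAt_const t ((0 : ℝ), (0 : ℝ)) using 1
    simp
  · simp [h0, h0']

/-! ### The turning point and the half period -/

/-- A decreasing orbit from `b` to `-b` turns the energy integral over positions into an integral
over time. -/
theorem integral_position_eq_integral_time {X X' : ℝ → ℝ} {b τ : ℝ} (hτ : 0 < τ)
    (hX : ∀ t, HasDerivAt X (X' t) t) (h0 : X 0 = b) (h1 : X τ = -b)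
    (hneg : ∀ t ∈ Ioo 0 τ, X' t < 0) (F : ℝ → ℝ) :
    ∫ x in (-b)..b, F x = ∫ t in Ioo 0 τ, |X' t| * F (X t) := by
  have hcont : Continuous X := continuous_iff_continuousAt.2 fun t => (hX t).continuousAt
  have hanti : StrictAntiOn X (Icc 0 τ) := by
    apply strictAntiOn_of_deriv_neg (convex_Icc 0 τ) hcont.continuousOn
    intro t ht
    rw [interior_Icc] at ht
    rw [(hX t).deriv]
    exact hneg t ht
  have himg : X '' Ioo 0 τ = Ioo (-b) b := by
    apply Subset.antisymm
    · rintro _ ⟨t, ht, rfl⟩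
      have ht' := Ioo_subset_Icc_self ht
      constructor
      · rw [← h1]; exact hanti ht' (right_mem_Icc.2 hτ.le) ht.2
      · rw [← h0]; exact hanti (left_mem_Icc.2 hτ.le) ht' ht.1
    · have := intermediate_value_Ioo' hτ.le (hcont.continuousOn (s := Icc 0 τ))
      rwa [h0, h1] at this
  have hb : -b ≤ b := by
    have := hanti (left_mem_Icc.2 hτ.le) (right_mem_Icc.2 hτ.le) hτ
    rw [h0, h1] at this
    exact this.le
  rw [intervalIntegral.integral_of_le hb, integral_Ioc_eq_integral_Ioo, ← himg]
  simpa using integral_image_eq_integral_abs_deriv_smul measurableSet_Ioo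
    (fun t _ => (hX t).hasDerivWithinAt) (hanti.mono Ioo_subset_Icc_self).injOn F

/-- For `b` near a nondegenerate turning point `a`, the amplitude of the energy level
`V b` is `b`. -/
theorem eventually_amplitude_eq {V : ℝ → ℝ} (hV : ContDiff ℝ ∞ V) {E a : ℝ} (hE : V 0 < E)
    (ha : IsLeast {x : ℝ | 0 < x ∧ V x = E} a) (hpos : 0 < deriv V a) :
    ∀ᶠ b in 𝓝 a, amplitude V (V b) = b := by
  have hc : Continuous (deriv V) := hV.continuous_deriv (by norm_cast)
  have hcV : Continuous V := hV.continuous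
  obtain ⟨δ, hδ, hball⟩ := Metric.mem_nhds_iff.1
    ((isOpen_lt continuous_const hc).mem_nhds (show a ∈ {x | 0 < deriv V x} from hpos))
  have ha0 : 0 < a := ha.1.1
  have hlt : ∀ x ∈ Ico 0 a, V x < E := by
    intro x hx
    by_contra! hge
    obtain ⟨z, hz, hz'⟩ := intermediate_value_Icc hx.1 hcV.continuousOn ⟨hE.le, hge⟩
    have hz0 : z ≠ 0 := by rintro rfl; exact hE.ne hz'
    exact absurd (ha.2 ⟨lt_of_le_of_ne hz.1 hz0.symm, hz'⟩) (not_le.2 (hz.2.trans_lt hx.2))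
  set r := max 0 (a - δ / 2) with hr
  have hra : r < a := max_lt ha0 (by linarith)
  obtain ⟨m, hm, hmax⟩ := isCompact_Icc.exists_isMaxOn (nonempty_Icc.2 (le_max_left 0 (a - δ / 2)))
    (hcV.continuousOn (s := Icc 0 r))
  have hmE : V m < V a := by
    rw [ha.1.2]; exact hlt m ⟨hm.1, hm.2.trans_lt hra⟩
  have e1 : ∀ᶠ b in 𝓝 a, V m < V b := hcV.continuousAt.eventually (lt_mem_nhds hmE)
  have e2 : ∀ᶠ b in 𝓝 a, b ∈ Ioo r (a + δ / 2) := Ioo_mem_nhds hra (by linarith)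
  filter_upwards [e1, e2] with b hb1 hb2
  have hmono : StrictMonoOn V (Icc r (a + δ / 2)) := by
    apply strictMonoOn_of_deriv_pos (convex_Icc _ _) hcV.continuousOn
    intro x hx
    rw [interior_Icc] at hx
    apply hball
    rw [Metric.mem_ball, Real.dist_eq, abs_lt]
    have := le_max_right 0 (a - δ / 2)
    constructor <;> linarith [hx.1, hx.2]
  have hr0 : 0 ≤ r := le_max_left _ _
  refine IsLeast.csInf_eq ⟨⟨hr0.trans_lt hb2.1, rfl⟩, ?_⟩
  rintro x ⟨hx0, hxb⟩
  by_contra! hlt'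
  rcases le_or_gt x r with hxr | hxr
  · exact absurd (hmax ⟨hx0.le, hxr⟩) (by simpa [hxb] using hb1)
  · exact (hmono ⟨hxr.le, (hlt'.trans hb2.2).le⟩ ⟨hb2.1.le, hb2.2.le⟩ hlt').ne hxb

/-- Below the turning point the potential stays below the energy level. -/
theorem potential_lt_energy {V : ℝ → ℝ} (hcV : Continuous V) (hVeven : ∀ x, V (-x) = V x)
    {E a : ℝ} (hE : V 0 < E) (ha : IsLeast {x : ℝ | 0 < x ∧ V x = E} a) {x : ℝ} (hx : |x| < a) :
    V x < E := by
  have habs : V x = V |x| := by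
    rcases abs_choice x with h | h <;> rw [h]
    exact (hVeven x).symm
  rw [habs]
  by_contra! hge
  obtain ⟨z, hz, hz'⟩ := intermediate_value_Icc (abs_nonneg x) hcV.continuousOn ⟨hE.le, hge⟩
  have hz0 : z ≠ 0 := by rintro rfl; exact hE.ne hz'
  exact absurd (ha.2 ⟨lt_of_le_of_ne hz.1 hz0.symm, hz'⟩) (not_le.2 (hz.2.trans_lt hx))

/-- The turning point is nondegenerate: otherwise the period integral would diverge, and its value
would be the convention `0`. -/
theorem deriv_potential_pos {V : ℝ → ℝ} (hV : ContDiff ℝ ∞ V) (hVeven : ∀ x, V (-x) = V x)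
    {E a : ℝ} (hE : V 0 < E) (ha : IsLeast {x : ℝ | 0 < x ∧ V x = E} a)
    (hT : 0 < period V E) : 0 < deriv V a := by
  have ha0 : 0 < a := ha.1.1
  have hd : Differentiable ℝ V := hV.differentiable (by simp)
  have hVlt : ∀ x, |x| < a → V x < E := fun x => potential_lt_energy hV.continuous hVeven hE ha
  have hge : 0 ≤ deriv V a := by
    have h1 : Tendsto (slope V a) (𝓝[<] a) (𝓝 (deriv V a)) :=
      (hasDerivAt_iff_tendsto_slope.1 (hd a).hasDerivAt).mono_left
        (nhdsWithin_mono _ fun x hx => ne_of_lt hx)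
    refine ge_of_tendsto h1 ?_
    filter_upwards [Ioo_mem_nhdsLT ha0] with x hx
    rw [slope_def_field, ha.1.2]
    have := hVlt x (by rw [abs_of_pos hx.1]; exact hx.2)
    exact div_nonneg_of_nonpos (by linarith) (by linarith [hx.2])
  refine lt_of_le_of_ne hge fun h0 => ?_
  have hamp : amplitude V E = a := ha.csInf_eq
  have hni : ¬ IntervalIntegrable (fun x => 1 / Real.sqrt (E - V x)) volume (-a) a := by
    intro hint
    obtain ⟨C, hC, htay⟩ := exists_taylor_bound (f := V) (hV.of_le (by norm_cast)) a
    have hint' : IntervalIntegrable (fun x => Real.sqrt C * (1 / Real.sqrt (E - V x))) volume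
        0 a := (hint.mono_set (by
          rw [uIcc_of_le ha0.le, uIcc_of_le (by linarith)]
          exact Icc_subset_Icc (by linarith) le_rfl)).const_mul _
    have : IntervalIntegrable (fun x : ℝ => (x - a)⁻¹) volume 0 a := by
      refine hint'.mono_fun (by fun_prop) ?_
      rw [Filter.EventuallyLE, ae_restrict_iff' measurableSet_uIoc]
      have hne : ∀ᵐ x : ℝ ∂volume, x ≠ a := by simp [ae_iff]
      filter_upwards [hne] with x hxa hx
      rw [uIoc_of_le ha0.le] at hx
      have hxlt : x < a := lt_of_le_of_ne hx.2 hxa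
      have hpos : 0 < E - V x := by
        have := hVlt x (by rw [abs_of_pos hx.1]; exact hxlt)
        linarith
      have hb := htay a ⟨by linarith, le_rfl⟩ x ⟨by linarith [hx.1], hx.2⟩
      rw [← h0, zero_mul, sub_zero, ha.1.2, abs_sub_comm, abs_of_pos hpos] at hb
      have hs : Real.sqrt (E - V x) ≤ Real.sqrt C * |x - a| := by
        rw [← Real.sqrt_sq_eq_abs, ← Real.sqrt_mul hC.le]
        exact Real.sqrt_le_sqrt hb
      have hs0 : 0 < Real.sqrt (E - V x) := Real.sqrt_pos.2 hpos
      have habs : 0 < |x - a| := abs_pos.2 (sub_ne_zero.2 hxa)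
      rw [norm_inv, Real.norm_eq_abs, Real.norm_of_nonneg (by positivity), mul_one_div,
        inv_eq_one_div, div_le_div_iff₀ habs hs0]
      linarith
    rw [intervalIntegrable_sub_inv_iff] at this
    rcases this with h | h
    · exact ha0.ne h
    · exact h right_mem_uIcc
  have : period V E = 0 := by
    unfold period
    rw [hamp, intervalIntegral.integral_undef hni, mul_zero]
  exact hT.ne' this

theorem exists_linear_lower_bound {g : ℝ → ℝ} {d b : ℝ} (hb : 0 ≤ b) (hg : Continuous g)
    (hd : HasDerivAt g d 0) (h0 : g 0 = 0) (hdpos : 0 < d) (hpos : ∀ t ∈ Ioc 0 b, 0 < g t) :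
    ∃ c > 0, ∀ t ∈ Icc 0 b, c * t ≤ g t := by
  have hcont : ContinuousOn (dslope g 0) univ :=
    (continuousOn_dslope univ_mem).2 ⟨hg.continuousOn, hd.differentiableAt⟩
  obtain ⟨m, hm, hmin⟩ := isCompact_Icc.exists_isMinOn (nonempty_Icc.2 hb)
    (hcont.mono (subset_univ (Icc 0 b)))
  refine ⟨dslope g 0 m, ?_, fun t ht => ?_⟩
  · rcases eq_or_lt_of_le hm.1 with h | h
    · rw [← h, dslope_same, hd.deriv]; exact hdpos
    · rw [dslope_of_ne _ h.ne', slope_def_field, h0]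
      have := hpos m ⟨h, hm.2⟩
      simp only [sub_zero]
      positivity
  · have h1 : dslope g 0 m ≤ dslope g 0 t := hmin ht
    have h2 : t * dslope g 0 t = g t := by
      have := sub_smul_dslope g 0 t
      simpa [h0] using this
    rw [← h2, mul_comm]
    exact mul_le_mul_of_nonneg_left h1 ht.1

/-- A function positive inside `[0, τ]` with simple zeros at both ends dominates the distance to
the ends. -/
theorem exists_min_lower_bound {g : ℝ → ℝ} {d d' τ : ℝ} (hτ : 0 < τ) (hg : Continuous g)
    (hd : HasDerivAt g d 0) (hd' : HasDerivAt g d' τ) (h0 : g 0 = 0) (h1 : g τ = 0)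
    (hdpos : 0 < d) (hdneg : d' < 0) (hpos : ∀ t ∈ Ioo 0 τ, 0 < g t) :
    ∃ c > 0, ∀ t ∈ Icc 0 τ, c * min t (τ - t) ≤ g t := by
  obtain ⟨c₁, hc₁, H₁⟩ := exists_linear_lower_bound (b := τ / 2) (by linarith) hg hd h0 hdpos
    fun t ht => hpos t ⟨ht.1, by linarith [ht.2]⟩
  obtain ⟨c₂, hc₂, H₂⟩ := exists_linear_lower_bound (g := fun t => g (τ - t)) (d := -d')
    (b := τ / 2) (by linarith) (by fun_prop)
    (HasDerivAt.comp_const_sub τ 0 (by simpa using hd'))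
    (by simpa using h1) (by linarith)
    fun t ht => hpos _ ⟨by linarith [ht.2], by linarith [ht.1]⟩
  refine ⟨min c₁ c₂, lt_min hc₁ hc₂, fun t ht => ?_⟩
  rcases le_total t (τ / 2) with h | h
  · rw [min_eq_left (a := t) (by linarith)]
    exact (mul_le_mul_of_nonneg_right (min_le_left _ _) ht.1).trans (H₁ t ⟨ht.1, h⟩)
  · rw [min_eq_right (a := t) (by linarith)]
    refine (mul_le_mul_of_nonneg_right (min_le_right _ _) (by linarith [ht.2])).trans ?_
    simpa using H₂ (τ - t) ⟨by linarith [ht.2], by linarith⟩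

theorem abs_le_mul_min_of_deriv_bound {f f' : ℝ → ℝ} {τ C : ℝ}
    (hf : ∀ t, HasDerivAt f (f' t) t) (h0 : f 0 = 0) (h1 : f τ = 0)
    (hC : ∀ t ∈ Icc 0 τ, |f' t| ≤ C) {t : ℝ} (ht : t ∈ Icc 0 τ) :
    |f t| ≤ C * min t (τ - t) := by
  have hτ : 0 ≤ τ := ht.1.trans ht.2
  have key : ∀ x ∈ Icc 0 τ, ‖f t - f x‖ ≤ C * ‖t - x‖ := fun x hx =>
    (convex_Icc 0 τ).norm_image_sub_le_of_norm_hasDerivWithin_le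
      (fun u _ => (hf u).hasDerivWithinAt) hC hx ht
  have k0 := key 0 (left_mem_Icc.2 hτ)
  have k1 := key τ (right_mem_Icc.2 hτ)
  rw [h0, sub_zero, sub_zero, Real.norm_eq_abs, Real.norm_eq_abs, abs_of_nonneg ht.1] at k0
  rw [h1, sub_zero, Real.norm_eq_abs, Real.norm_eq_abs, abs_sub_comm t τ,
    abs_of_nonneg (show (0 : ℝ) ≤ τ - t by linarith [ht.2])] at k1
  rcases min_choice t (τ - t) with h | h <;> rw [h] <;> assumption

/-- The energy of an oscillator solution is conserved. -/
theorem energy_conserved {V φ φ' : ℝ → ℝ} (hV : Differentiable ℝ V)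
    (hφ : ∀ t, HasDerivAt φ (φ' t) t) (hφ' : ∀ t, HasDerivAt φ' (-deriv V (φ t)) t)
    (h0' : φ' 0 = 0) (t : ℝ) : φ' t ^ 2 / 2 + V (φ t) = V (φ 0) := by
  have hd : ∀ t, HasDerivAt (fun t => φ' t ^ 2 / 2 + V (φ t)) 0 t := by
    intro t
    have h1 := ((hφ' t).pow 2).div_const 2
    have h2 := (hV (φ t)).hasDerivAt.comp t (hφ t)
    convert! h1.add h2 using 1
    simp
    ring
  have := is_const_of_deriv_eq_zero (fun t => (hd t).differentiableAt) (fun t => (hd t).deriv) t 0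
  simpa [h0'] using this

/-- An oscillator solution starting at rest at the turning point `a`, and at rest at half the
period, descends monotonically from `a` to `-a` during that time. -/
theorem half_period_descent {V : ℝ → ℝ} (hV : ContDiff ℝ ∞ V) (hVeven : ∀ x, V (-x) = V x)
    {E a T : ℝ} (hE : V 0 < E) (ha : IsLeast {x : ℝ | 0 < x ∧ V x = E} a)
    (hT : T = period V E) (hT0 : 0 < T) {φ φ' : ℝ → ℝ}
    (hφ : ∀ t, HasDerivAt φ (φ' t) t) (hφ' : ∀ t, HasDerivAt φ' (-deriv V (φ t)) t)
    (h0 : φ 0 = a) (h0' : φ' 0 = 0) (hT2 : φ' (T / 2) = 0) :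
    (∀ t ∈ Ioo 0 (T / 2), φ' t < 0) ∧ φ (T / 2) = -a := by
  have hpos : 0 < deriv V a := deriv_potential_pos hV hVeven hE ha (hT ▸ hT0)
  have hd : Differentiable ℝ V := hV.differentiable (by simp)
  have hcφ : Continuous φ := continuous_iff_continuousAt.2 fun t => (hφ t).continuousAt
  have hcφ' : Continuous φ' := continuous_iff_continuousAt.2 fun t => (hφ' t).continuousAt
  have hen : ∀ t, φ' t ^ 2 / 2 + V (φ t) = E := by
    intro t
    rw [energy_conserved hd hφ hφ' h0' t, h0, ha.1.2]
  have ha0 : 0 < a := ha.1.1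
  -- The velocity is negative right after the start.
  have hstart : ∀ᶠ t in 𝓝[>] (0 : ℝ), φ' t < 0 := by
    have h1 : Tendsto (slope φ' 0) (𝓝[>] 0) (𝓝 (-deriv V a)) := by
      have := hasDerivAt_iff_tendsto_slope.1 (hφ' 0)
      rw [h0] at this
      exact this.mono_left (nhdsWithin_mono _ fun x hx => ne_of_gt hx)
    filter_upwards [h1.eventually (gt_mem_nhds (show -deriv V a < 0 by linarith)),
      self_mem_nhdsWithin] with t ht ht0
    rw [slope_def_field, h0', sub_zero, sub_zero] at ht
    have ht0' : (0 : ℝ) < t := ht0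
    by_contra! h
    exact absurd ht (not_lt.2 (div_nonneg h ht0'.le))
  obtain ⟨δ, hδ, hδneg⟩ := (mem_nhdsGT_iff_exists_Ioo_subset).1 hstart
  have hδ0 : (0 : ℝ) < δ := hδ
  have hδT : δ ≤ T / 2 := by
    by_contra! h
    have : φ' (T / 2) < 0 := hδneg ⟨by linarith, h⟩
    exact this.ne hT2
  -- The first instant `τ` at which the orbit is at rest again.
  obtain ⟨τ, ⟨hτmem, hτ0'⟩, hτleast⟩ := ((isCompact_Icc (a := δ) (b := T / 2)).inter_right
    (isClosed_eq hcφ' continuous_const)).exists_isLeast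
    (⟨T / 2, ⟨hδT, le_rfl⟩, hT2⟩ : (Icc δ (T / 2) ∩ {t | φ' t = 0}).Nonempty)
  have hτ0 : 0 < τ := hδ0.trans_le hτmem.1
  have hτ0'' : φ' τ = 0 := hτ0'
  have hneg : ∀ t ∈ Ioo 0 τ, φ' t < 0 := by
    intro t ht
    rcases lt_or_ge t δ with h | h
    · exact hδneg ⟨ht.1, h⟩
    by_contra! hge
    have hmid : φ' (δ / 2) < 0 := hδneg ⟨by linarith, by linarith⟩
    obtain ⟨z, hz, hz0⟩ := intermediate_value_Icc (show δ / 2 ≤ t by linarith)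
      hcφ'.continuousOn ⟨hmid.le, hge⟩
    have hzδ : δ ≤ z := by
      by_contra! hlt
      exact (hδneg ⟨by linarith [hz.1], hlt⟩ : φ' z < 0).ne hz0
    exact absurd (hτleast ⟨⟨hzδ, by linarith [hz.2, ht.2, hτmem.2]⟩, hz0⟩)
      (not_le.2 (hz.2.trans_lt ht.2))
  have hanti : StrictAntiOn φ (Icc 0 τ) := by
    apply strictAntiOn_of_deriv_neg (convex_Icc 0 τ) hcφ.continuousOn
    intro t ht
    rw [interior_Icc] at ht
    rw [(hφ t).deriv]
    exact hneg t ht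
  have hlt : φ τ < a := by
    have := hanti (left_mem_Icc.2 hτ0.le) (right_mem_Icc.2 hτ0.le) hτ0
    rwa [h0] at this
  have hVτ : V (φ τ) = E := by
    have := hen τ
    rw [hτ0''] at this
    linarith
  have hend : φ τ = -a := by
    have hle : φ τ ≤ -a := by
      by_contra! h
      exact (potential_lt_energy hV.continuous hVeven hE ha (abs_lt.2 ⟨h, hlt⟩)).ne hVτ
    refine le_antisymm hle ?_
    by_contra! h
    obtain ⟨z, hz, hz'⟩ := intermediate_value_Ioo' hτ0.le (hcφ.continuousOn (s := Icc 0 τ))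
      (show -a ∈ Ioo (φ τ) (φ 0) from ⟨h, by rw [h0]; linarith⟩)
    have h1 := hen z
    rw [hz', hVeven, ha.1.2] at h1
    have h2 := hneg z hz
    nlinarith
  -- Its value is `T / 2` by the formula for the period.
  have hτT : τ = T / 2 := by
    have hper : T = Real.sqrt 2 * ∫ t in Ioo 0 τ, Real.sqrt 2 := by
      rw [hT, period, show amplitude V E = a from ha.csInf_eq,
        integral_position_eq_integral_time hτ0 hφ h0 hend hneg]
      congr 1
      refine setIntegral_congr_fun measurableSet_Ioo fun t ht => ?_
      have h1 : E - V (φ t) = φ' t ^ 2 / 2 := by linarith [hen t]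
      have h2 : 0 < |φ' t| := abs_pos.2 (hneg t ht).ne
      rw [h1, Real.sqrt_div (sq_nonneg _), Real.sqrt_sq_eq_abs]
      field_simp
    rw [setIntegral_const, smul_eq_mul, measureReal_def, Real.volume_Ioo, sub_zero,
      ENNReal.toReal_ofReal hτ0.le] at hper
    have : Real.sqrt 2 * Real.sqrt 2 = 2 := Real.mul_self_sqrt (by norm_num)
    linear_combination (-1 / 2) * hper - τ / 2 * this
  rw [← hτT]
  exact ⟨hneg, hend⟩

/-! ### Nondegeneracy of the periodic orbit -/

theorem abs_div_sqrt_sub_sqrt_two_le {x y δ : ℝ} (hx : 0 < x) (hδ0 : 0 ≤ δ) (hδ : δ ≤ 1 / 2)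
    (h : |2 * y - x ^ 2| ≤ δ * x ^ 2) :
    |x * (1 / Real.sqrt y) - Real.sqrt 2| ≤ Real.sqrt 2 * δ := by
  obtain ⟨h1, h2⟩ := abs_le.1 h
  have hx2 : 0 < x ^ 2 := by positivity
  have hy : 0 < y := by nlinarith
  have hs : 0 < Real.sqrt y := Real.sqrt_pos.2 hy
  have hsq : Real.sqrt 2 * Real.sqrt y = Real.sqrt (2 * y) := (Real.sqrt_mul (by norm_num) y).symm
  have hup : x ≤ (1 + δ) * Real.sqrt (2 * y) := by
    rw [← Real.sqrt_sq (show 0 ≤ 1 + δ by linarith), ← Real.sqrt_mul (sq_nonneg _)]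
    apply Real.le_sqrt_of_sq_le
    have : (1 + δ) ^ 2 * ((1 - δ) * x ^ 2) ≤ (1 + δ) ^ 2 * (2 * y) :=
      mul_le_mul_of_nonneg_left (by linarith) (sq_nonneg _)
    have h3 : 1 ≤ (1 + δ) ^ 2 * (1 - δ) := by nlinarith [mul_nonneg hδ0 hδ0]
    nlinarith
  have hlow : (1 - δ) * Real.sqrt (2 * y) ≤ x := by
    rw [← Real.sqrt_sq (show 0 ≤ 1 - δ by linarith), ← Real.sqrt_mul (sq_nonneg _)]
    apply Real.sqrt_le_iff.2 ⟨hx.le, ?_⟩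
    have : (1 - δ) ^ 2 * (2 * y) ≤ (1 - δ) ^ 2 * ((1 + δ) * x ^ 2) :=
      mul_le_mul_of_nonneg_left (by linarith) (sq_nonneg _)
    have h3 : (1 - δ) ^ 2 * (1 + δ) ≤ 1 := by nlinarith [mul_nonneg hδ0 hδ0]
    nlinarith
  have heq : x * (1 / Real.sqrt y) - Real.sqrt 2 = (x - Real.sqrt (2 * y)) / Real.sqrt y := by
    rw [← hsq]; field_simp
  rw [heq, abs_div, abs_of_pos hs, div_le_iff₀ hs,
    show Real.sqrt 2 * δ * Real.sqrt y = δ * Real.sqrt (2 * y) by rw [← hsq]; ring, abs_le]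
  constructor <;> linarith

theorem deriv_neg_of_even {V : ℝ → ℝ} (hVeven : ∀ x, V (-x) = V x) (x : ℝ) :
    deriv V (-x) = -deriv V x := by
  have h := deriv_comp_neg V x
  rw [funext hVeven] at h
  rw [h, neg_neg]

/-- The key estimate. If the linearised equation has a solution `w` that is at rest at both ends of
the half period `τ`, with `w 0 = 1` and `w τ = -1`, then `φ + η w` descends from `a + η` to
`-(a + η)` in time `τ`, and its energy differs from `V (a + η)` by `O(η²)` times its squared
velocity. Substituting it into the period integral shows that the period is stationary. -/
theorem period_perturbation {V : ℝ → ℝ} (hV : ContDiff ℝ ∞ V) (hVeven : ∀ x, V (-x) = V x)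
    {E a τ : ℝ} (hE : V 0 < E) (ha : IsLeast {x : ℝ | 0 < x ∧ V x = E} a)
    (hpos : 0 < deriv V a) (hτ : 0 < τ) {φ φ' w w' : ℝ → ℝ}
    (hφ : ∀ t, HasDerivAt φ (φ' t) t) (hφ' : ∀ t, HasDerivAt φ' (-deriv V (φ t)) t)
    (hw : ∀ t, HasDerivAt w (w' t) t)
    (hw' : ∀ t, HasDerivAt w' (-deriv (deriv V) (φ t) * w t) t)
    (φ0 : φ 0 = a) (φ0' : φ' 0 = 0) (φτ : φ τ = -a) (φτ' : φ' τ = 0)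
    (hneg : ∀ t ∈ Ioo 0 τ, φ' t < 0)
    (w0 : w 0 = 1) (w0' : w' 0 = 0) (wτ : w τ = -1) (wτ' : w' τ = 0) :
    ∃ K : ℝ, ∀ᶠ η in 𝓝[>] (0 : ℝ), |period V (V (a + η)) - 2 * τ| ≤ K * η ^ 2 := by
  have hd : Differentiable ℝ V := hV.differentiable (by simp)
  have hV1 : ContDiff ℝ ∞ (deriv V) := (contDiff_infty_iff_deriv.1 hV).2
  have hV2 : ContDiff ℝ ∞ (deriv (deriv V)) := (contDiff_infty_iff_deriv.1 hV1).2
  have hcφ : Continuous φ := continuous_iff_continuousAt.2 fun t => (hφ t).continuousAt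
  have hcφ' : Continuous φ' := continuous_iff_continuousAt.2 fun t => (hφ' t).continuousAt
  have hcw : Continuous w := continuous_iff_continuousAt.2 fun t => (hw t).continuousAt
  have hcw' : Continuous w' := continuous_iff_continuousAt.2 fun t => (hw' t).continuousAt
  have hcV1 := hV1.continuous
  have hcV2 := hV2.continuous
  -- Bounds on `[0, τ]`.
  obtain ⟨Rφ, hRφ⟩ := isCompact_Icc.exists_bound_of_continuousOn (hcφ.continuousOn (s := Icc 0 τ))
  obtain ⟨Rw, hRw⟩ := isCompact_Icc.exists_bound_of_continuousOn (hcw.continuousOn (s := Icc 0 τ))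
  obtain ⟨D₁, hD₁⟩ := isCompact_Icc.exists_bound_of_continuousOn
    ((hcV1.comp hcφ).neg.continuousOn (s := Icc 0 τ))
  obtain ⟨D₂, hD₂⟩ := isCompact_Icc.exists_bound_of_continuousOn
    (((hcV2.comp hcφ).neg.mul hcw).continuousOn (s := Icc 0 τ))
  have hmem0 : (0 : ℝ) ∈ Icc 0 τ := left_mem_Icc.2 hτ.le
  have hRφ0 : 0 ≤ Rφ := (norm_nonneg _).trans (hRφ 0 hmem0)
  have hRw0 : 0 ≤ Rw := (norm_nonneg _).trans (hRw 0 hmem0)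
  have hD₁0 : 0 ≤ D₁ := (norm_nonneg _).trans (hD₁ 0 hmem0)
  have hD₂0 : 0 ≤ D₂ := (norm_nonneg _).trans (hD₂ 0 hmem0)
  obtain ⟨C₀, hC₀, htay⟩ := exists_taylor_bound (hV1.of_le (by norm_cast)) (Rφ + Rw)
  obtain ⟨c, hc, hlow⟩ := exists_min_lower_bound (g := fun t => -φ' t) hτ hcφ'.neg
    (hφ' 0).neg (hφ' τ).neg (by simp [φ0']) (by simp [φτ']) (by simpa [φ0] using hpos)
    (by rw [φτ, deriv_neg_of_even hVeven]; simpa using hpos) fun t ht => by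
      have := hneg t ht
      linarith
  set C₂ := C₀ * Rw ^ 2 with hC₂
  set D := D₁ + D₂ with hD
  have hC₂0 : 0 ≤ C₂ := by positivity
  have hD0 : 0 ≤ D := by positivity
  set K := 4 * (D * C₂) / c ^ 2 with hK
  have hK0 : 0 ≤ K := by positivity
  refine ⟨2 * (2 * K) * τ, ?_⟩
  have hamp : ∀ᶠ η in 𝓝[>] (0 : ℝ), amplitude V (V (a + η)) = a + η := by
    have h1 : Tendsto (fun η : ℝ => a + η) (𝓝[>] 0) (𝓝 a) := by
      have : Tendsto (fun η : ℝ => a + η) (𝓝 0) (𝓝 (a + 0)) :=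
        (continuous_const.add continuous_id).tendsto 0
      rw [add_zero] at this
      exact this.mono_left nhdsWithin_le_nhds
    exact h1.eventually (eventually_amplitude_eq hV hE ha hpos)
  have hs1 : ∀ᶠ η in 𝓝[>] (0 : ℝ), η ≤ 1 :=
    nhdsWithin_le_nhds (Iic_mem_nhds one_pos)
  have hs2 : ∀ᶠ η in 𝓝[>] (0 : ℝ), η * D₂ < c / 2 := by
    have : Tendsto (fun η : ℝ => η * D₂) (𝓝 0) (𝓝 (0 * D₂)) :=
      (continuous_id.mul continuous_const).tendsto 0
    rw [zero_mul] at this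
    exact (this.mono_left nhdsWithin_le_nhds).eventually (gt_mem_nhds (by positivity))
  have hs3 : ∀ᶠ η in 𝓝[>] (0 : ℝ), 2 * K * η ^ 2 < 1 / 2 := by
    have : Tendsto (fun η : ℝ => 2 * K * η ^ 2) (𝓝 0) (𝓝 (2 * K * 0 ^ 2)) :=
      (continuous_const.mul (continuous_id.pow 2)).tendsto 0
    rw [zero_pow (by norm_num), mul_zero] at this
    exact (this.mono_left nhdsWithin_le_nhds).eventually (gt_mem_nhds (by norm_num))
  filter_upwards [hamp, hs1, hs2, hs3, self_mem_nhdsWithin] with η hamp hη1 hη2 hη3 hη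
  have hη0 : 0 < η := hη
  set X : ℝ → ℝ := fun t => φ t + η * w t with hX
  set X' : ℝ → ℝ := fun t => φ' t + η * w' t with hX'
  have hXd : ∀ t, HasDerivAt X (X' t) t := fun t => (hφ t).add ((hw t).const_mul η)
  have hXd' : ∀ t, HasDerivAt X' (-deriv V (φ t) + η * (-deriv (deriv V) (φ t) * w t)) t :=
    fun t => (hφ' t).add ((hw' t).const_mul η)
  have hX0 : X 0 = a + η := by simp [hX, φ0, w0]
  have hXτ : X τ = -(a + η) := by simp [hX, φτ, wτ]; ring
  have hcX : Continuous X := continuous_iff_continuousAt.2 fun t => (hXd t).continuousAt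
  have hcX' : Continuous X' := continuous_iff_continuousAt.2 fun t => (hXd' t).continuousAt
  have hm0 : ∀ t ∈ Icc 0 τ, 0 ≤ min t (τ - t) := fun t ht => le_min ht.1 (by linarith [ht.2])
  have hw'm : ∀ t ∈ Icc 0 τ, |w' t| ≤ D₂ * min t (τ - t) := fun t ht =>
    abs_le_mul_min_of_deriv_bound hw' w0' wτ' hD₂ ht
  have hφ'm : ∀ t ∈ Icc 0 τ, |φ' t| ≤ D₁ * min t (τ - t) := fun t ht =>
    abs_le_mul_min_of_deriv_bound hφ' φ0' φτ' hD₁ ht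
  have hX'up : ∀ t ∈ Icc 0 τ, |X' t| ≤ D * min t (τ - t) := by
    intro t ht
    calc |X' t| ≤ |φ' t| + |η * w' t| := abs_add_le _ _
      _ = |φ' t| + η * |w' t| := by rw [abs_mul, abs_of_pos hη0]
      _ ≤ |φ' t| + 1 * |w' t| := by gcongr
      _ ≤ D₁ * min t (τ - t) + D₂ * min t (τ - t) := by
          rw [one_mul]; exact add_le_add (hφ'm t ht) (hw'm t ht)
      _ = _ := by rw [hD]; ring
  have hX'low : ∀ t ∈ Icc 0 τ, c / 2 * min t (τ - t) ≤ -X' t := by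
    intro t ht
    have h1 := hlow t ht
    have h2 := (abs_le.1 (hw'm t ht)).2
    have h3 : η * w' t ≤ c / 2 * min t (τ - t) := by
      calc η * w' t ≤ η * (D₂ * min t (τ - t)) := by gcongr
        _ = (η * D₂) * min t (τ - t) := by ring
        _ ≤ _ := mul_le_mul_of_nonneg_right hη2.le (hm0 t ht)
    have h4 : X' t = φ' t + η * w' t := rfl
    rw [h4]
    linarith
  have hX'neg : ∀ t ∈ Ioo 0 τ, X' t < 0 := by
    intro t ht
    have h1 := hX'low t (Ioo_subset_Icc_self ht)
    have h2 : 0 < min t (τ - t) := lt_min ht.1 (by linarith [ht.2])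
    nlinarith [mul_pos (half_pos hc) h2]
  -- The energy along `X` and its rate of change.
  set H : ℝ → ℝ := fun t => X' t ^ 2 / 2 + V (X t) with hH
  set H' : ℝ → ℝ := fun t => X' t *
    (deriv V (X t) - deriv V (φ t) - deriv (deriv V) (φ t) * (X t - φ t)) with hH'
  have hHd : ∀ t, HasDerivAt H (H' t) t := by
    intro t
    have h1 := ((hXd' t).pow 2).div_const 2
    have h2 := (hd (X t)).hasDerivAt.comp t (hXd t)
    convert! h1.add h2 using 1
    simp only [hH', hX]
    push_cast
    ring
  have hH'b : ∀ t ∈ Icc 0 τ, |H' t| ≤ D * C₂ * η ^ 2 * min t (τ - t) := by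
    intro t ht
    have hφR := hRφ t ht
    have hwR := hRw t ht
    rw [Real.norm_eq_abs] at hφR hwR
    have hηw : |η * w t| ≤ Rw := by
      rw [abs_mul, abs_of_pos hη0]
      calc η * |w t| ≤ 1 * |w t| := by gcongr
        _ ≤ Rw := by rwa [one_mul]
    have h1 := htay (φ t) (abs_le.1 (by linarith)) (X t)
      (abs_le.1 ((abs_add_le _ _).trans (by linarith)))
    have h2 : (X t - φ t) ^ 2 ≤ Rw ^ 2 * η ^ 2 := by
      have : X t - φ t = η * w t := by simp [hX]
      rw [this, mul_pow, mul_comm]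
      exact mul_le_mul_of_nonneg_right (sq_le_sq' (abs_le.1 hwR).1 (abs_le.1 hwR).2) (sq_nonneg η)
    rw [hH', abs_mul]
    calc _ ≤ (D * min t (τ - t)) * (C₀ * (Rw ^ 2 * η ^ 2)) := by
          gcongr
          · exact mul_nonneg hD0 (hm0 t ht)
          · exact hX'up t ht
          · exact h1.trans (by gcongr)
      _ = _ := by rw [hC₂]; ring
  have hH0 : H 0 = V (a + η) := by simp [hH, hX', hX0, φ0', w0']
  have hHτ : H τ = V (a + η) := by
    rw [hH]
    simp only [hXτ, hX', φτ', wτ', hVeven]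
    ring
  have hHb : ∀ t ∈ Icc 0 τ, |H t - V (a + η)| ≤ D * C₂ * η ^ 2 * min t (τ - t) ^ 2 := by
    intro t ht
    have hP : 0 ≤ D * C₂ * η ^ 2 := by positivity
    -- Integrate `H'` from the nearer end of `[0, τ]`, where `H` equals `V (a + η)`.
    rcases min_choice t (τ - t) with h | h
    · rw [h, ← hH0]
      have := (convex_Icc 0 t).norm_image_sub_le_of_norm_hasDerivWithin_le
        (f := H) (f' := H') (C := D * C₂ * η ^ 2 * t)
        (fun u _ => (hHd u).hasDerivWithinAt)
        (fun u hu => (hH'b u ⟨hu.1, hu.2.trans ht.2⟩).trans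
          (mul_le_mul_of_nonneg_left ((min_le_left _ _).trans hu.2) hP))
        (left_mem_Icc.2 ht.1) (right_mem_Icc.2 ht.1)
      rw [Real.norm_eq_abs, sub_zero, Real.norm_of_nonneg ht.1] at this
      linarith
    · rw [h, ← hHτ]
      have := (convex_Icc t τ).norm_image_sub_le_of_norm_hasDerivWithin_le
        (f := H) (f' := H') (C := D * C₂ * η ^ 2 * (τ - t))
        (fun u _ => (hHd u).hasDerivWithinAt)
        (fun u hu => (hH'b u ⟨ht.1.trans hu.1, hu.2⟩).trans
          (mul_le_mul_of_nonneg_left ((min_le_right _ _).trans (by linarith [hu.1])) hP))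
        (left_mem_Icc.2 ht.2) (right_mem_Icc.2 ht.2)
      rw [Real.norm_eq_abs, abs_sub_comm, Real.norm_of_nonneg (by linarith [ht.2])] at this
      linarith
  have hratio : ∀ t ∈ Ioo 0 τ, |(|X' t| * (1 / Real.sqrt (V (a + η) - V (X t)))) - Real.sqrt 2|
      ≤ Real.sqrt 2 * (2 * K * η ^ 2) := by
    intro t ht
    have ht' := Ioo_subset_Icc_self ht
    apply abs_div_sqrt_sub_sqrt_two_le (abs_pos.2 (hX'neg t ht).ne) (by positivity) hη3.le
    have h1 : 2 * (V (a + η) - V (X t)) - |X' t| ^ 2 = -(2 * (H t - V (a + η))) := by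
      rw [sq_abs]; simp only [hH]; ring
    have h2 : min t (τ - t) ^ 2 ≤ 4 / c ^ 2 * |X' t| ^ 2 := by
      have h3 : c / 2 * min t (τ - t) ≤ |X' t| := (hX'low t ht').trans (neg_le_abs _)
      have h4 : (c / 2 * min t (τ - t)) ^ 2 ≤ |X' t| ^ 2 :=
        pow_le_pow_left₀ (mul_nonneg (by positivity) (hm0 t ht')) h3 2
      rw [div_mul_eq_mul_div, le_div_iff₀ (by positivity)]
      linarith
    rw [h1, abs_neg, abs_mul, abs_two]
    calc 2 * |H t - V (a + η)| ≤ 2 * (D * C₂ * η ^ 2 * (4 / c ^ 2 * |X' t| ^ 2)) := by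
          gcongr
          exact (hHb t ht').trans (by gcongr)
      _ = _ := by rw [hK]; ring
  set r : ℝ → ℝ := fun t => |X' t| * (1 / Real.sqrt (V (a + η) - V (X t))) with hr
  have hfin : volume (Ioo (0 : ℝ) τ) < ⊤ := by simp
  have hmeas : Measurable r := by
    have hcV := hV.continuous
    apply Measurable.mul (by fun_prop)
    apply Measurable.div (by fun_prop) (by fun_prop)
  have hint : IntegrableOn r (Ioo 0 τ) := by
    refine Measure.integrableOn_of_bounded (M := Real.sqrt 2 * (2 * K * η ^ 2) + Real.sqrt 2)
      hfin.ne hmeas.aestronglyMeasurable ?_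
    rw [ae_restrict_iff' measurableSet_Ioo]
    refine ae_of_all _ fun t ht => ?_
    have := hratio t ht
    rw [Real.norm_eq_abs]
    calc |r t| = |(r t - Real.sqrt 2) + Real.sqrt 2| := by ring_nf
      _ ≤ |r t - Real.sqrt 2| + |Real.sqrt 2| := abs_add_le _ _
      _ ≤ _ := by rw [abs_of_nonneg (Real.sqrt_nonneg 2)]; gcongr
  have hvol : volume.real (Ioo (0 : ℝ) τ) = τ := by simp [measureReal_def, hτ.le]
  have hsub : (∫ t in Ioo 0 τ, r t) - Real.sqrt 2 * τ = ∫ t in Ioo 0 τ, (r t - Real.sqrt 2) := by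
    rw [integral_sub hint (by simp), setIntegral_const, smul_eq_mul, hvol, mul_comm]
  have hbound := norm_setIntegral_le_of_norm_le_const (f := fun t => r t - Real.sqrt 2) hfin hratio
  have h22 : Real.sqrt 2 * Real.sqrt 2 = 2 := Real.mul_self_sqrt (by norm_num)
  rw [period, hamp, integral_position_eq_integral_time hτ hXd hX0 hXτ hX'neg,
    show Real.sqrt 2 * (∫ t in Ioo 0 τ, |X' t| * (1 / Real.sqrt (V (a + η) - V (X t)))) - 2 * τ
      = Real.sqrt 2 * ((∫ t in Ioo 0 τ, r t) - Real.sqrt 2 * τ) by rw [mul_sub, ← mul_assoc, h22],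
    hsub, abs_mul, abs_of_nonneg (Real.sqrt_nonneg 2)]
  rw [Real.norm_eq_abs, hvol] at hbound
  calc _ ≤ Real.sqrt 2 * (Real.sqrt 2 * (2 * K * η ^ 2) * τ) := by gcongr
    _ = (Real.sqrt 2 * Real.sqrt 2) * (2 * K * η ^ 2) * τ := by ring
    _ = _ := by rw [h22]; ring

/-- Nondegeneracy of the periodic orbit: if the period depends on the energy to first order, the
linearised equation has no nonzero even periodic solution. -/
theorem linearized_solution_eq_zero {V : ℝ → ℝ} (hV : ContDiff ℝ ∞ V)
    (hVeven : ∀ x, V (-x) = V x) {E a T : ℝ} (hE : V 0 < E)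
    (ha : IsLeast {x : ℝ | 0 < x ∧ V x = E} a) (hT : T = period V E) (hT0 : 0 < T)
    (hdeg : deriv (period V) E ≠ 0) {φ φ' w w' : ℝ → ℝ}
    (hφ : ∀ t, HasDerivAt φ (φ' t) t) (hφ' : ∀ t, HasDerivAt φ' (-deriv V (φ t)) t)
    (hw : ∀ t, HasDerivAt w (w' t) t)
    (hw' : ∀ t, HasDerivAt w' (-deriv (deriv V) (φ t) * w t) t)
    (φ0 : φ 0 = a) (φ0' : φ' 0 = 0) (φτ' : φ' (T / 2) = 0) (hφb : ∃ R, ∀ t, |φ t| ≤ R)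
    (w0' : w' 0 = 0) (wτ' : w' (T / 2) = 0) (t : ℝ) : w t = 0 := by
  have hV1 : ContDiff ℝ ∞ (deriv V) := (contDiff_infty_iff_deriv.1 hV).2
  have hV2 : ContDiff ℝ ∞ (deriv (deriv V)) := (contDiff_infty_iff_deriv.1 hV1).2
  obtain ⟨R, hR⟩ := hφb
  obtain ⟨Q, hQ⟩ := (isCompact_Icc (a := -R) (b := R)).exists_bound_of_continuousOn
    hV2.continuous.continuousOn
  have hq : ∀ t, |deriv (deriv V) (φ t)| ≤ Q := fun t => hQ _ (abs_le.1 (hR t))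
  by_cases hw0 : w 0 = 0
  · exact linear_ode_eq_zero hq hw hw' hw0 w0' t
  exfalso
  have hpos : 0 < deriv V a := deriv_potential_pos hV hVeven hE ha (hT ▸ hT0)
  have hd : Differentiable ℝ V := hV.differentiable (by simp)
  have hd1 : Differentiable ℝ (deriv V) := hV1.differentiable (by simp)
  obtain ⟨hneg, φτ⟩ := half_period_descent hV hVeven hE ha hT hT0 hφ hφ' φ0 φ0' φτ'
  -- The Wronskian of `w` and `φ'` determines `w` at half the period.
  have hwr : ∀ t, HasDerivAt (fun t => w t * -deriv V (φ t) - w' t * φ' t) 0 t := by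
    intro t
    have h1 := ((hd1 (φ t)).hasDerivAt.comp t (hφ t)).neg
    convert! ((hw t).mul h1).sub ((hw' t).mul (hφ' t)) using 1
    simp
    ring
  have hwτ : w (T / 2) = -w 0 := by
    have := is_const_of_deriv_eq_zero (fun t => (hwr t).differentiableAt)
      (fun t => (hwr t).deriv) (T / 2) 0
    simp only [φτ', φ0', mul_zero, sub_zero, φτ, φ0, deriv_neg_of_even hVeven, neg_neg] at this
    have h2 : (w (T / 2) + w 0) * deriv V a = 0 := by linarith
    rcases mul_eq_zero.1 h2 with h | h
    · linarith
    · exact absurd h hpos.ne'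
  obtain ⟨K, hK⟩ := period_perturbation hV hVeven hE ha hpos (by linarith : 0 < T / 2) hφ hφ'
    (w := fun t => (w 0)⁻¹ * w t) (w' := fun t => (w 0)⁻¹ * w' t)
    (fun t => (hw t).const_mul _)
    (fun t => by
      convert! (hw' t).const_mul (w 0)⁻¹ using 1
      ring)
    φ0 φ0' φτ φτ' hneg (inv_mul_cancel₀ hw0) (by simp [w0'])
    (by rw [hwτ, mul_neg, inv_mul_cancel₀ hw0]) (by simp [wτ'])
  -- Hence `η ↦ period V (V (a + η))` has right derivative `0` at `0`, against the chain rule.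
  have hdiff : DifferentiableAt ℝ (period V) E := by
    by_contra h
    exact hdeg (deriv_zero_of_not_differentiableAt h)
  have hchain : HasDerivAt (fun η => period V (V (a + η))) (deriv (period V) E * deriv V a) 0 := by
    have h1 : HasDerivAt (fun η => V (a + η)) (deriv V a) 0 :=
      HasDerivAt.comp_const_add a 0 (by simpa using (hd a).hasDerivAt)
    have h2 : HasDerivAt (period V) (deriv (period V) E) (V (a + 0)) := by
      rw [add_zero, ha.1.2]; exact hdiff.hasDerivAt
    exact HasDerivAt.comp (h₂ := period V) 0 h2 h1
  have hlim := (hasDerivAt_iff_tendsto_slope.1 hchain).mono_left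
    (nhdsWithin_mono _ fun x (hx : x ∈ Ioi (0 : ℝ)) => ne_of_gt hx)
  have hlim0 : Tendsto (slope (fun η => period V (V (a + η))) 0) (𝓝[>] 0) (𝓝 0) := by
    refine squeeze_zero_norm' (a := fun η => K * η) ?_ ?_
    · filter_upwards [hK, self_mem_nhdsWithin] with η h1 h2
      have hη : (0 : ℝ) < η := h2
      rw [slope_def_field, add_zero, ha.1.2, ← hT, sub_zero, norm_div, Real.norm_eq_abs,
        Real.norm_of_nonneg hη.le, div_le_iff₀ hη]
      rw [show (2 : ℝ) * (T / 2) = T by ring] at h1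
      linarith
    · have : Tendsto (fun η : ℝ => K * η) (𝓝 0) (𝓝 (K * 0)) :=
        (continuous_const.mul continuous_id).tendsto 0
      rw [mul_zero] at this
      exact this.mono_left nhdsWithin_le_nhds
  exact mul_ne_zero hdeg hpos.ne' (tendsto_nhds_unique hlim hlim0)

/-! ### Fourier coefficients of the forced oscillator -/

theorem fourierC_eq_fourierCoeffOn (T : ℝ) [hT : Fact (0 < T)] (f : ℝ → ℝ) (m : ℤ) :
    fourierC T f m = fourierCoeffOn hT.out (fun t => (f t : ℂ)) m := by
  rw [fourierCoeffOn_eq_integral, fourierC, sub_zero, Complex.real_smul]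
  push_cast
  congr 1
  apply intervalIntegral.integral_congr
  intro t _
  beta_reduce
  rw [smul_eq_mul, fourier_coe_apply]
  congr 2
  push_cast
  ring

theorem hasSum_sq_fourierC (T : ℝ) [hT : Fact (0 < T)] {f : ℝ → ℝ} (hf : Continuous f) :
    HasSum (fun m : ℤ => ‖fourierC T f m‖ ^ 2) (T⁻¹ * ∫ t in (0 : ℝ)..T, f t ^ 2) := by
  have hc : Continuous fun t => (f t : ℂ) := by fun_prop
  have hL2 : MemLp (fun t => (f t : ℂ)) 2 (volume.restrict (Ioc 0 T)) := by
    obtain ⟨M, hM⟩ := isCompact_Icc.exists_bound_of_continuousOn (hc.continuousOn (s := Icc 0 T))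
    refine MemLp.of_bound hc.aestronglyMeasurable M ?_
    rw [ae_restrict_iff' measurableSet_Ioc]
    exact ae_of_all _ fun t ht => hM t (Ioc_subset_Icc_self ht)
  have := hasSum_sq_fourierCoeffOn hT.out hL2
  simpa [fourierC_eq_fourierCoeffOn] using this

theorem fourierC_deriv (T : ℝ) [hT : Fact (0 < T)] {f f' : ℝ → ℝ} (hf : ∀ t, HasDerivAt f (f' t) t)
    (hf' : Continuous f') (hper : Function.Periodic f T) (m : ℤ) :
    fourierC T f' m = (2 * Real.pi * Complex.I * m / T) * fourierC T f m := by
  have hT0 : (T : ℂ) ≠ 0 := by exact_mod_cast hT.out.ne'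
  have hcf : Continuous f := continuous_iff_continuousAt.2 fun t => (hf t).continuousAt
  have hu : ∀ t : ℝ, HasDerivAt
      (fun t : ℝ => Complex.exp (-(2 * Real.pi * Complex.I * m * t / T)))
      (-(2 * Real.pi * Complex.I * m / T) *
        Complex.exp (-(2 * Real.pi * Complex.I * m * t / T))) t := by
    intro t
    have h1 : HasDerivAt (fun t : ℝ => -(2 * Real.pi * Complex.I * m * (t : ℂ) / T))
        (-(2 * Real.pi * Complex.I * m / T)) t := by
      have := ((Complex.ofRealCLM.hasDerivAt (x := t)).const_mul
        (2 * Real.pi * Complex.I * m)).div_const (T : ℂ) |>.neg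
      convert! this using 1
      simp
    convert! h1.cexp using 1
    ring
  have hv : ∀ t : ℝ, HasDerivAt (fun t : ℝ => (f t : ℂ)) (f' t : ℂ) t :=
    fun t => (hf t).ofReal_comp
  have key := intervalIntegral.integral_mul_deriv_eq_deriv_mul (a := 0) (b := T)
    (fun t _ => hu t) (fun t _ => hv t)
    (Continuous.intervalIntegrable (by fun_prop) _ _)
    (Continuous.intervalIntegrable (by fun_prop) _ _)
  have hexp : Complex.exp (-(2 * Real.pi * Complex.I * m * T / T)) = 1 := by
    rw [mul_div_assoc, div_self hT0, mul_one, Complex.exp_eq_one_iff]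
    exact ⟨-m, by push_cast; ring⟩
  have hfT : f T = f 0 := by simpa using hper 0
  rw [hexp, hfT] at key
  simp only [Complex.ofReal_zero, mul_zero, zero_div, neg_zero, Complex.exp_zero, one_mul,
    sub_self, zero_sub] at key
  unfold fourierC
  rw [key]
  simp only [mul_assoc, neg_mul, intervalIntegral.integral_neg,
    intervalIntegral.integral_const_mul, neg_neg]
  ring

/-- The Fourier coefficients of a `T`-periodic solution of `v'' + v = g`. -/
theorem fourierC_oscillator (T : ℝ) [hT : Fact (0 < T)] {v v' g : ℝ → ℝ}
    (hv : ∀ t, HasDerivAt v (v' t) t) (hv' : ∀ t, HasDerivAt v' (g t - v t) t)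
    (hg : Continuous g) (hper : Function.Periodic v T) (m : ℤ) :
    ((1 - (2 * Real.pi * m / T) ^ 2 : ℝ) : ℂ) * fourierC T v m = fourierC T g m := by
  have hcv : Continuous v := continuous_iff_continuousAt.2 fun t => (hv t).continuousAt
  have hcv' : Continuous v' := continuous_iff_continuousAt.2 fun t => (hv' t).continuousAt
  have hper' : Function.Periodic v' T := by
    intro t
    have h1 : HasDerivAt (fun t => v (t + T)) (v' (t + T)) t := (hv (t + T)).comp_add_const t T
    rw [show (fun t => v (t + T)) = v from funext hper] at h1
    exact h1.unique (hv t)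
  have h1 := fourierC_deriv T hv hcv' hper m
  have h2 := fourierC_deriv T hv' (hg.sub hcv) hper' m
  have h3 : fourierC T (fun t => g t - v t) m = fourierC T g m - fourierC T v m := by
    unfold fourierC
    rw [← mul_sub, ← intervalIntegral.integral_sub
      (Continuous.intervalIntegrable (by fun_prop) _ _)
      (Continuous.intervalIntegrable (by fun_prop) _ _)]
    congr 2
    funext t
    push_cast
    ring
  rw [h3, h1] at h2
  push_cast
  linear_combination (-1 : ℂ) * h2 + (-(2 * Real.pi * m / T : ℂ) ^ 2 * fourierC T v m) *
    Complex.I_sq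

/-- Nonresonance: the multiplier `(1 + m²) / (1 - (2πm/T)²)` is bounded. -/
theorem exists_multiplier_bound (T : ℝ) [hT : Fact (0 < T)]
    (hres : ∀ n : ℕ, T ≠ 2 * Real.pi * n) :
    ∃ κ > 0, ∀ m : ℤ, 1 + (m : ℝ) ^ 2 ≤ κ * |1 - (2 * Real.pi * m / T) ^ 2| := by
  have hT0 := hT.out
  set β := 2 * Real.pi / T with hβ
  have hβ0 : 0 < β := by positivity
  have hform : ∀ m : ℤ, 2 * Real.pi * m / T = β * m := fun m => by rw [hβ]; ring
  simp only [hform]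
  have hne : ∀ m : ℤ, 1 - (β * m) ^ 2 ≠ 0 := by
    intro m h
    have h1 : (β * m) ^ 2 = 1 := by linarith
    have h2 : |β * m| = 1 := by
      rw [← sq_abs] at h1
      nlinarith [abs_nonneg (β * m)]
    rw [abs_mul, abs_of_pos hβ0, hβ, div_mul_eq_mul_div, div_eq_one_iff_eq hT0.ne'] at h2
    apply hres m.natAbs
    rw [← h2, Nat.cast_natAbs, Int.cast_abs]
  have hrat : Tendsto (fun m : ℤ => (m : ℝ) ^ 2) cofinite atTop := by
    have h1 : Tendsto (fun m : ℤ => |(m : ℝ)|) cofinite atTop := by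
      exact (tendsto_norm_cocompact_atTop (E := ℝ)).comp Int.tendsto_coe_cofinite
    have := (tendsto_pow_atTop (α := ℝ) two_ne_zero).comp h1
    simpa [Function.comp_def] using this
  have hfin : ∀ᶠ m : ℤ in cofinite, 1 + (m : ℝ) ^ 2 ≤ (4 / β ^ 2) * |1 - (β * m) ^ 2| := by
    filter_upwards [hrat.eventually_ge_atTop (2 / β ^ 2), hrat.eventually_ge_atTop 1] with m h1 h2
    rw [div_le_iff₀ (by positivity)] at h1
    rw [abs_sub_comm, abs_of_nonneg (by nlinarith), div_mul_eq_mul_div, le_div_iff₀ (by positivity)]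
    nlinarith
  -- For large `m` the quotient is at most `4 / β²`; the finitely many others are added up.
  rw [Filter.eventually_cofinite] at hfin
  refine ⟨4 / β ^ 2 + ∑ m ∈ hfin.toFinset, (1 + (m : ℝ) ^ 2) / |1 - (β * m) ^ 2|, by positivity,
    fun m => ?_⟩
  have hpos : 0 < |1 - (β * m) ^ 2| := abs_pos.2 (hne m)
  have hsum : ∀ m : ℤ, 0 ≤ (1 + (m : ℝ) ^ 2) / |1 - (β * m) ^ 2| := fun m => by positivity
  by_cases hm : m ∈ hfin.toFinset
  · have h1 := Finset.single_le_sum (fun i _ => hsum i) hm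
    rw [div_le_iff₀ hpos] at h1
    refine h1.trans ?_
    gcongr
    have : 0 ≤ 4 / β ^ 2 := by positivity
    linarith
  · have h1 : 1 + (m : ℝ) ^ 2 ≤ (4 / β ^ 2) * |1 - (β * m) ^ 2| := by
      by_contra h
      exact hm (by simpa using h)
    refine h1.trans ?_
    gcongr
    have := Finset.sum_nonneg (s := hfin.toFinset) fun i _ => hsum i
    linarith

/-! ### Variation of parameters -/

/-- `∫₀ᵗ cos(s) g(s) ds`. -/
def cosInt (g : ℝ → ℝ) (t : ℝ) : ℝ := ∫ s in (0 : ℝ)..t, Real.cos s * g s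

/-- `∫₀ᵗ sin(s) g(s) ds`. -/
def sinInt (g : ℝ → ℝ) (t : ℝ) : ℝ := ∫ s in (0 : ℝ)..t, Real.sin s * g s

/-- The value at `0` for which the solution of `v'' + v = g`, `v'(0) = 0` is at rest at `T / 2`. -/
def oscInit (T : ℝ) (g : ℝ → ℝ) : ℝ :=
  (Real.cos (T / 2) * cosInt g (T / 2) + Real.sin (T / 2) * sinInt g (T / 2)) / Real.sin (T / 2)

/-- The `T`-periodic solution of `v'' + v = g`, for `g` even and `T`-periodic, by variation of
parameters. -/
def oscSol (T : ℝ) (g : ℝ → ℝ) (t : ℝ) : ℝ :=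
  oscInit T g * Real.cos t + Real.sin t * cosInt g t - Real.cos t * sinInt g t

/-- The derivative of `oscSol`. -/
def oscSol' (T : ℝ) (g : ℝ → ℝ) (t : ℝ) : ℝ :=
  -(oscInit T g * Real.sin t) + Real.cos t * cosInt g t + Real.sin t * sinInt g t

section

variable {T : ℝ} {g : ℝ → ℝ}

theorem hasDerivAt_cosInt (hg : Continuous g) (t : ℝ) :
    HasDerivAt (cosInt g) (Real.cos t * g t) t :=
  (Real.continuous_cos.mul hg).integral_hasStrictDerivAt 0 t |>.hasDerivAt

theorem hasDerivAt_sinInt (hg : Continuous g) (t : ℝ) :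
    HasDerivAt (sinInt g) (Real.sin t * g t) t :=
  (Real.continuous_sin.mul hg).integral_hasStrictDerivAt 0 t |>.hasDerivAt

theorem hasDerivAt_oscSol (hg : Continuous g) (t : ℝ) :
    HasDerivAt (oscSol T g) (oscSol' T g t) t := by
  have h := (((Real.hasDerivAt_cos t).const_mul (oscInit T g)).add
    ((Real.hasDerivAt_sin t).mul (hasDerivAt_cosInt hg t))).sub
    ((Real.hasDerivAt_cos t).mul (hasDerivAt_sinInt hg t))
  convert! h using 1
  rw [oscSol']
  ring

theorem hasDerivAt_oscSol' (hg : Continuous g) (t : ℝ) :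
    HasDerivAt (oscSol' T g) (g t - oscSol T g t) t := by
  have h := (((Real.hasDerivAt_sin t).const_mul (oscInit T g)).neg.add
    ((Real.hasDerivAt_cos t).mul (hasDerivAt_cosInt hg t))).add
    ((Real.hasDerivAt_sin t).mul (hasDerivAt_sinInt hg t))
  convert! h using 1
  rw [oscSol]
  linear_combination (-g t) * Real.sin_sq_add_cos_sq t

theorem sinInt_neg (hge : ∀ t, g (-t) = g t) (t : ℝ) : sinInt g (-t) = sinInt g t := by
  have := intervalIntegral.integral_comp_neg (a := 0) (b := t) fun s => Real.sin s * g s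
  simp only [Real.sin_neg, hge, neg_mul, intervalIntegral.integral_neg, neg_zero] at this
  rw [sinInt, sinInt, intervalIntegral.integral_symm, ← this, neg_neg]

theorem cosInt_neg (hge : ∀ t, g (-t) = g t) (t : ℝ) : cosInt g (-t) = -cosInt g t := by
  have := intervalIntegral.integral_comp_neg (a := 0) (b := t) fun s => Real.cos s * g s
  simp only [Real.cos_neg, hge, neg_zero] at this
  rw [cosInt, cosInt, intervalIntegral.integral_symm, ← this]

theorem oscSol_neg (hge : ∀ t, g (-t) = g t) (t : ℝ) : oscSol T g (-t) = oscSol T g t := by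
  simp [oscSol, sinInt_neg hge, cosInt_neg hge]

theorem oscSol'_neg (hge : ∀ t, g (-t) = g t) (t : ℝ) : oscSol' T g (-t) = -oscSol' T g t := by
  simp [oscSol', sinInt_neg hge, cosInt_neg hge]
  ring

theorem sin_half_ne_zero (hT : 0 < T) (hres : ∀ n : ℕ, T ≠ 2 * Real.pi * n) :
    Real.sin (T / 2) ≠ 0 := by
  intro h
  obtain ⟨n, hn⟩ := Real.sin_eq_zero_iff.1 h
  have hn0 : (0 : ℝ) < n := by
    have : 0 < (n : ℝ) * Real.pi := by rw [hn]; linarith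
    exact (pos_iff_pos_of_mul_pos this).2 Real.pi_pos
  have hn0' : 0 ≤ n := by exact_mod_cast hn0.le
  apply hres n.toNat
  have : ((n.toNat : ℕ) : ℝ) = n := by exact_mod_cast Int.toNat_of_nonneg hn0'
  rw [this]
  linarith

theorem oscSol'_half (hs : Real.sin (T / 2) ≠ 0) : oscSol' T g (T / 2) = 0 := by
  rw [oscSol', oscInit]
  field_simp
  ring

/-- The solution that is at rest at `0` and at `T / 2` is periodic, by reflection. -/
theorem periodic_oscSol (hs : Real.sin (T / 2) ≠ 0) (hg : Continuous g)
    (hge : ∀ t, g (-t) = g t) (hgp : Function.Periodic g T) :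
    Function.Periodic (oscSol T g) T := by
  -- The difference `v(s + T) - v(s)` solves `d'' + d = 0` with vanishing data at `s = -T/2`.
  set d : ℝ → ℝ := fun t => oscSol T g (t - T / 2 + T) - oscSol T g (t - T / 2) with hd
  set d' : ℝ → ℝ := fun t => oscSol' T g (t - T / 2 + T) - oscSol' T g (t - T / 2) with hd'
  have h1 : ∀ t, HasDerivAt d (d' t) t := by
    intro t
    have e2 := (hasDerivAt_oscSol (T := T) hg (t - T / 2)).comp_sub_const t (T / 2)
    have e1 : HasDerivAt (fun t => oscSol T g (t - T / 2 + T)) (oscSol' T g (t - T / 2 + T)) t :=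
      HasDerivAt.comp_add_const (f := oscSol T g) (t - T / 2) T
        (hasDerivAt_oscSol hg _) |>.comp_sub_const t (T / 2)
    exact e1.sub e2
  have h2 : ∀ t, HasDerivAt d' (-(1 : ℝ) * d t) t := by
    intro t
    have e2 := (hasDerivAt_oscSol' (T := T) hg (t - T / 2)).comp_sub_const t (T / 2)
    have e1 : HasDerivAt (fun t => oscSol' T g (t - T / 2 + T))
        (g (t - T / 2 + T) - oscSol T g (t - T / 2 + T)) t :=
      HasDerivAt.comp_add_const (f := oscSol' T g) (t - T / 2) T
        (hasDerivAt_oscSol' hg _) |>.comp_sub_const t (T / 2)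
    convert! e1.sub e2 using 1
    simp only [hd, hgp (t - T / 2)]
    ring
  have h0 : d 0 = 0 := by
    simp only [hd]
    rw [show 0 - T / 2 + T = T / 2 by ring, show 0 - T / 2 = -(T / 2) by ring, oscSol_neg hge,
      sub_self]
  have h0' : d' 0 = 0 := by
    simp only [hd']
    rw [show 0 - T / 2 + T = T / 2 by ring, show 0 - T / 2 = -(T / 2) by ring, oscSol'_neg hge,
      oscSol'_half hs]
    simp
  intro t
  have := linear_ode_eq_zero (q := fun _ => 1) (K := 1) (by simp) h1 h2 h0 h0' (t + T / 2)
  simp only [hd, add_sub_cancel_right] at this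
  linarith

/-- A Lipschitz constant of `oscSol T g` for `|g| ≤ 1`. -/
def oscLip (T : ℝ) : ℝ := 2 * (T / |Real.sin (T / 2)| + T)

theorem abs_trigInt_le {c : ℝ → ℝ} (hc : ∀ s, |c s| ≤ 1) {M : ℝ} (hM : ∀ t, |g t| ≤ M) {t : ℝ}
    (ht : t ∈ Icc 0 T) : |∫ s in (0 : ℝ)..t, c s * g s| ≤ T * M := by
  have hM0 : 0 ≤ M := (abs_nonneg _).trans (hM 0)
  have h := intervalIntegral.norm_integral_le_of_norm_le_const (a := 0) (b := t) (C := M)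
    (f := fun s => c s * g s) fun s _ => by
      rw [norm_mul]
      calc ‖c s‖ * ‖g s‖ ≤ 1 * M := by gcongr; exacts [hc s, hM s]
        _ = M := one_mul M
  rw [sub_zero, abs_of_nonneg ht.1, Real.norm_eq_abs] at h
  calc _ ≤ M * t := h
    _ ≤ T * M := by rw [mul_comm]; gcongr; exact ht.2

theorem abs_mul_le_of_le {x y M : ℝ} (hx : |x| ≤ 1) (hy : |y| ≤ M) : |x * y| ≤ M := by
  rw [abs_mul]
  calc |x| * |y| ≤ 1 * M := by gcongr
    _ = M := one_mul M

theorem abs_oscSol'_le_of_mem (hT : 0 < T) (hs : Real.sin (T / 2) ≠ 0) {M : ℝ}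
    (hM : ∀ t, |g t| ≤ M) {t : ℝ} (ht : t ∈ Icc 0 T) : |oscSol' T g t| ≤ oscLip T * M := by
  have hM0 : 0 ≤ M := (abs_nonneg _).trans (hM 0)
  have hmem : T / 2 ∈ Icc 0 T := ⟨by linarith, by linarith⟩
  have hs0 : 0 < |Real.sin (T / 2)| := abs_pos.2 hs
  have hinit : |oscInit T g| ≤ 2 * (T * M) / |Real.sin (T / 2)| := by
    rw [oscInit, abs_div]
    gcongr
    refine (abs_add_le _ _).trans ?_
    have h1 := abs_mul_le_of_le (Real.abs_cos_le_one (T / 2))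
      (abs_trigInt_le Real.abs_cos_le_one hM hmem)
    have h2 := abs_mul_le_of_le (Real.abs_sin_le_one (T / 2))
      (abs_trigInt_le Real.abs_sin_le_one hM hmem)
    unfold cosInt sinInt
    linarith
  have h1 := abs_mul_le_of_le (Real.abs_sin_le_one t) hinit
  have h2 := abs_mul_le_of_le (Real.abs_cos_le_one t) (abs_trigInt_le Real.abs_cos_le_one hM ht)
  have h3 := abs_mul_le_of_le (Real.abs_sin_le_one t) (abs_trigInt_le Real.abs_sin_le_one hM ht)
  calc |oscSol' T g t|
      ≤ |Real.sin t * oscInit T g| + |Real.cos t * cosInt g t| + |Real.sin t * sinInt g t| := by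
        rw [oscSol', mul_comm (oscInit T g)]
        refine (abs_add_le _ _).trans (add_le_add_left ((abs_add_le _ _).trans ?_) _)
        rw [abs_neg]
    _ ≤ 2 * (T * M) / |Real.sin (T / 2)| + T * M + T * M := by
        unfold cosInt sinInt
        linarith
    _ = oscLip T * M := by rw [oscLip]; ring

theorem abs_oscSol'_le (hT : 0 < T) (hs : Real.sin (T / 2) ≠ 0) (hg : Continuous g)
    (hge : ∀ t, g (-t) = g t) (hgp : Function.Periodic g T) {M : ℝ}
    (hM : ∀ t, |g t| ≤ M) (t : ℝ) : |oscSol' T g t| ≤ oscLip T * M := by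
  have hper : Function.Periodic (oscSol' T g) T := by
    intro t
    have h1 := (hasDerivAt_oscSol (T := T) hg (t + T)).comp_add_const t T
    rw [show (fun t => oscSol T g (t + T)) = oscSol T g from
      funext (periodic_oscSol hs hg hge hgp)] at h1
    exact h1.unique (hasDerivAt_oscSol hg t)
  obtain ⟨s, hs', hs''⟩ := hper.exists_mem_Ico₀ hT t
  rw [hs'']
  exact abs_oscSol'_le_of_mem hT hs hM ⟨hs'.1, hs'.2.le⟩

end

/-! ### The solution operator on even periodic functions -/

section

variable {T : ℝ}

/-- The even part of a continuous function on the circle, as a `T`-periodic function on `ℝ`. -/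
def evenPart (f : C(AddCircle T, ℝ)) (t : ℝ) : ℝ :=
  (f (t : AddCircle T) + f ((-t : ℝ) : AddCircle T)) / 2

theorem continuous_evenPart (f : C(AddCircle T, ℝ)) : Continuous (evenPart f) := by
  have h : Continuous fun t : ℝ => (t : AddCircle T) := AddCircle.continuous_mk' T
  unfold evenPart
  have h1 : Continuous fun t : ℝ => f (t : AddCircle T) := f.continuous.comp h
  have h2 : Continuous fun t : ℝ => f ((-t : ℝ) : AddCircle T) :=
    f.continuous.comp (h.comp continuous_neg)
  exact (h1.add h2).div_const 2

theorem evenPart_neg (f : C(AddCircle T, ℝ)) (t : ℝ) : evenPart f (-t) = evenPart f t := by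
  rw [evenPart, evenPart, neg_neg, add_comm]

theorem periodic_evenPart (f : C(AddCircle T, ℝ)) : Function.Periodic (evenPart f) T := by
  intro t
  have h1 : ((t + T : ℝ) : AddCircle T) = t := AddCircle.coe_add_period T t
  have h2 : ((-(t + T) : ℝ) : AddCircle T) = ((-t : ℝ) : AddCircle T) := by
    rw [AddCircle.coe_neg, h1, AddCircle.coe_neg]
  rw [evenPart, evenPart, h1, h2]

theorem evenPart_eq {f : C(AddCircle T, ℝ)}
    (hf : ∀ t : ℝ, f ((-t : ℝ) : AddCircle T) = f (t : AddCircle T)) (t : ℝ) :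
    evenPart f t = f (t : AddCircle T) := by
  rw [evenPart, hf]
  ring

theorem evenPart_add (f g : C(AddCircle T, ℝ)) :
    evenPart (f + g) = fun t => evenPart f t + evenPart g t := by
  funext t
  simp [evenPart]
  ring

theorem evenPart_smul (c : ℝ) (f : C(AddCircle T, ℝ)) :
    evenPart (c • f) = fun t => c * evenPart f t := by
  funext t
  simp [evenPart]
  ring

theorem oscSol_add {g h : ℝ → ℝ} (hg : Continuous g) (hh : Continuous h) (t : ℝ) :
    oscSol T (fun t => g t + h t) t = oscSol T g t + oscSol T h t := by
  have h1 : ∀ t, cosInt (fun t => g t + h t) t = cosInt g t + cosInt h t := by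
    intro t
    simp only [cosInt, mul_add]
    exact intervalIntegral.integral_add (Continuous.intervalIntegrable (by fun_prop) _ _)
      (Continuous.intervalIntegrable (by fun_prop) _ _)
  have h2 : ∀ t, sinInt (fun t => g t + h t) t = sinInt g t + sinInt h t := by
    intro t
    simp only [sinInt, mul_add]
    exact intervalIntegral.integral_add (Continuous.intervalIntegrable (by fun_prop) _ _)
      (Continuous.intervalIntegrable (by fun_prop) _ _)
  simp only [oscSol, oscInit, h1, h2]
  ring

theorem oscSol_smul (c : ℝ) (g : ℝ → ℝ) (t : ℝ) :
    oscSol T (fun t => c * g t) t = c * oscSol T g t := by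
  have h1 : ∀ t, cosInt (fun t => c * g t) t = c * cosInt g t := by
    intro t
    simp only [cosInt, mul_left_comm _ c]
    exact intervalIntegral.integral_const_mul _ _
  have h2 : ∀ t, sinInt (fun t => c * g t) t = c * sinInt g t := by
    intro t
    simp only [sinInt, mul_left_comm _ c]
    exact intervalIntegral.integral_const_mul _ _
  simp only [oscSol, oscInit, h1, h2]
  ring

theorem circle_ext {f g : C(AddCircle T, ℝ)}
    (h : ∀ t : ℝ, f (t : AddCircle T) = g (t : AddCircle T)) : f = g := by
  ext x
  induction x using QuotientAddGroup.induction_on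
  exact h _

variable [hT : Fact (0 < T)]

theorem abs_evenPart_le (f : C(AddCircle T, ℝ)) (t : ℝ) : |evenPart f t| ≤ ‖f‖ := by
  have h1 := f.norm_coe_le_norm (t : AddCircle T)
  have h2 := f.norm_coe_le_norm ((-t : ℝ) : AddCircle T)
  rw [Real.norm_eq_abs] at h1 h2
  rw [evenPart, abs_div, abs_two]
  have := abs_add_le (f (t : AddCircle T)) (f ((-t : ℝ) : AddCircle T))
  linarith

theorem norm_weightedC_oscillator_le {κ : ℝ}
    (hκ : ∀ m : ℤ, 1 + (m : ℝ) ^ 2 ≤ κ * |1 - (2 * Real.pi * m / T) ^ 2|)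
    {v v' g : ℝ → ℝ} (hv : ∀ t, HasDerivAt v (v' t) t) (hv' : ∀ t, HasDerivAt v' (g t - v t) t)
    (hg : Continuous g) (hper : Function.Periodic v T) (m : ℤ) :
    ‖weightedC T v m‖ ≤ κ * ‖fourierC T g m‖ := by
  rw [← fourierC_oscillator T hv hv' hg hper m, weightedC, norm_mul, norm_mul, Complex.norm_real,
    Complex.norm_real, ← mul_assoc, Real.norm_of_nonneg (by positivity), Real.norm_eq_abs]
  gcongr
  exact hκ m

theorem memLp_fourierC {g : ℝ → ℝ} (hg : Continuous g) : Memℓp (fourierC T g) 2 := by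
  apply memℓp_gen
  simpa using (hasSum_sq_fourierC T hg).summable

theorem norm_fourierC_le {g : ℝ → ℝ} (hg : Continuous g) {M : ℝ} (hM : ∀ t, |g t| ≤ M) :
    ‖(⟨fourierC T g, memLp_fourierC hg⟩ : lp (fun _ : ℤ => ℂ) 2)‖ ≤ M := by
  have hM0 : 0 ≤ M := (abs_nonneg _).trans (hM 0)
  have hT0 := hT.out
  apply lp.norm_le_of_tsum_le (by norm_num) hM0
  have h := (hasSum_sq_fourierC T hg).tsum_eq
  have h2 : T⁻¹ * ∫ t in (0 : ℝ)..T, g t ^ 2 ≤ M ^ 2 := by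
    have h3 : ∫ t in (0 : ℝ)..T, g t ^ 2 ≤ ∫ t in (0 : ℝ)..T, M ^ 2 := by
      apply intervalIntegral.integral_mono_on hT0.le
        (Continuous.intervalIntegrable (by fun_prop) _ _)
        (Continuous.intervalIntegrable (by fun_prop) _ _)
      intro t _
      exact sq_le_sq' (abs_le.1 (hM t)).1 (abs_le.1 (hM t)).2
    rw [intervalIntegral.integral_const, smul_eq_mul, sub_zero] at h3
    rw [inv_mul_le_iff₀ hT0]
    exact h3
  simpa [h] using h2

theorem oscSol_mem_evenH2 (hres : ∀ n : ℕ, T ≠ 2 * Real.pi * n) {g : ℝ → ℝ}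
    (hg : Continuous g) (hge : ∀ t, g (-t) = g t) (hgp : Function.Periodic g T) :
    oscSol T g ∈ evenH2 T := by
  have hs := sin_half_ne_zero hT.out hres
  have hper := periodic_oscSol hs hg hge hgp
  refine ⟨continuous_iff_continuousAt.2 fun t => (hasDerivAt_oscSol hg t).continuousAt, hper,
    oscSol_neg hge, ?_⟩
  obtain ⟨κ, -, hκ⟩ := exists_multiplier_bound T hres
  exact ((memLp_fourierC hg).norm.const_mul κ).mono
    (norm_weightedC_oscillator_le hκ (hasDerivAt_oscSol hg) (hasDerivAt_oscSol' hg) hg hper)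

/-- The solution operator `f ↦ v` of `v'' + v = f`, from continuous functions on the circle to
`H²_e(0,T)`; the odd part of `f` is discarded. -/
def solOp (hres : ∀ n : ℕ, T ≠ 2 * Real.pi * n) : C(AddCircle T, ℝ) →L[ℝ] H2e T :=
  LinearMap.mkContinuousOfExistsBound
    { toFun := fun f => (⟨oscSol T (evenPart f), oscSol_mem_evenH2 hres
        (continuous_evenPart f) (evenPart_neg f) (periodic_evenPart f)⟩ : evenH2 T)
      map_add' := fun f g => Subtype.ext (funext fun t => by
        change oscSol T (evenPart (f + g)) t = oscSol T (evenPart f) t + oscSol T (evenPart g) t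
        rw [evenPart_add, oscSol_add (continuous_evenPart f) (continuous_evenPart g)])
      map_smul' := fun c f => Subtype.ext (funext fun t => by
        change oscSol T (evenPart (c • f)) t = c * oscSol T (evenPart f) t
        rw [evenPart_smul, oscSol_smul]) }
    (by
      obtain ⟨κ, hκ0, hκ⟩ := exists_multiplier_bound T hres
      have hs := sin_half_ne_zero hT.out hres
      refine ⟨κ, fun f => ?_⟩
      have hg := continuous_evenPart f
      have hper := periodic_oscSol hs hg (evenPart_neg f) (periodic_evenPart f)
      let c : lp (fun _ : ℤ => ℂ) 2 := ⟨fourierC T (evenPart f), memLp_fourierC hg⟩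
      have h1 : ‖c‖ ≤ ‖f‖ := norm_fourierC_le hg (abs_evenPart_le f)
      change ‖toSeq T _‖ ≤ _
      calc _ ≤ ‖κ • c‖ := by
            apply lp.norm_mono (by norm_num)
            intro m
            have := norm_weightedC_oscillator_le hκ (hasDerivAt_oscSol hg)
              (hasDerivAt_oscSol' hg) hg hper m
            change _ ≤ ‖κ • fourierC T (evenPart f) m‖
            rw [norm_smul, Real.norm_of_nonneg hκ0.le]
            exact this
        _ ≤ κ * ‖f‖ := by
            rw [norm_smul, Real.norm_of_nonneg hκ0.le]
            gcongr)

theorem solOp_apply (hres : ∀ n : ℕ, T ≠ 2 * Real.pi * n) (f : C(AddCircle T, ℝ)) :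
    (solOp hres f).1 = oscSol T (evenPart f) := rfl

/-- Even periodic classical solutions of `v'' + v = f` are exactly the values of `solOp`. -/
theorem eq_solOp_iff (hres : ∀ n : ℕ, T ≠ 2 * Real.pi * n) {f : C(AddCircle T, ℝ)}
    (hf : ∀ t : ℝ, f ((-t : ℝ) : AddCircle T) = f (t : AddCircle T)) (v : H2e T) :
    v = solOp hres f ↔ Differentiable ℝ v.1 ∧ ∀ t : ℝ, DifferentiableAt ℝ (deriv v.1) t ∧
      deriv (deriv v.1) t + v.1 t = f (t : AddCircle T) := by
  have hg := continuous_evenPart f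
  have hs := sin_half_ne_zero hT.out hres
  constructor
  · rintro rfl
    rw [solOp_apply]
    have h1 : deriv (oscSol T (evenPart f)) = oscSol' T (evenPart f) :=
      funext fun t => (hasDerivAt_oscSol hg t).deriv
    refine ⟨fun t => (hasDerivAt_oscSol hg t).differentiableAt, fun t => ?_⟩
    rw [h1, (hasDerivAt_oscSol' hg t).deriv, evenPart_eq hf]
    exact ⟨(hasDerivAt_oscSol' hg t).differentiableAt, by ring⟩
  · rintro ⟨hd, hd'⟩
    apply toSeq_injective T
    apply lp.ext
    funext m
    change weightedC T v.1 m = weightedC T (oscSol T (evenPart f)) m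
    have hv' : ∀ t, HasDerivAt (deriv v.1) (evenPart f t - v.1 t) t := by
      intro t
      rw [evenPart_eq hf, ← (hd' t).2, add_sub_cancel_right]
      exact (hd' t).1.hasDerivAt
    have h1 := fourierC_oscillator T (fun t => (hd t).hasDerivAt) hv' hg v.2.2.1 m
    have h2 := fourierC_oscillator T (hasDerivAt_oscSol (T := T) hg) (hasDerivAt_oscSol' hg) hg
      (periodic_oscSol hs hg (evenPart_neg f) (periodic_evenPart f)) m
    obtain ⟨κ, hκ0, hκ⟩ := exists_multiplier_bound T hres
    have hne : ((1 - (2 * Real.pi * m / T) ^ 2 : ℝ) : ℂ) ≠ 0 := by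
      intro h0
      have h0' : 1 - (2 * Real.pi * m / T) ^ 2 = 0 := by exact_mod_cast h0
      have := hκ m
      rw [h0', abs_zero, mul_zero] at this
      nlinarith [sq_nonneg (m : ℝ)]
    rw [weightedC, weightedC, mul_left_cancel₀ hne (h1.trans h2.symm)]

theorem summable_inv_one_add_sq : Summable fun m : ℤ => (1 + (m : ℝ) ^ 2)⁻¹ := by
  refine Summable.of_norm_bounded_eventually
    (Real.summable_one_div_int_pow (p := 2).2 (by norm_num)) ?_
  filter_upwards [(finite_singleton (0 : ℤ)).compl_mem_cofinite] with m hm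
  have hm0 : (m : ℝ) ≠ 0 := by exact_mod_cast hm
  have : 0 < (m : ℝ) ^ 2 := by positivity
  rw [Real.norm_of_nonneg (by positivity), ← one_div]
  gcongr
  linarith

/-- The Sobolev embedding of `H²_e(0,T)` in the bounded functions. -/
theorem abs_apply_le_norm (f : H2e T) (t : ℝ) :
    |f.1 t| ≤ (∑' m : ℤ, (1 + (m : ℝ) ^ 2)⁻¹) * ‖f‖ := by
  have hgp : Function.Periodic (fun t => (f.1 t : ℂ)) T := fun t => by simp [f.2.2.1 t]
  have hgc : Continuous (hgp.lift : AddCircle T → ℂ) :=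
    (show Continuous (fun t => (f.1 t : ℂ)) from
      Complex.continuous_ofReal.comp f.2.1).quotient_lift _
  let g : C(AddCircle T, ℂ) := ⟨hgp.lift, hgc⟩
  have hgt : ∀ t : ℝ, g (t : AddCircle T) = (f.1 t : ℂ) := fun t => rfl
  have hcoef : ∀ m : ℤ, fourierCoeff (g : AddCircle T → ℂ) m = fourierC T f.1 m := by
    intro m
    rw [fourierC_eq_fourierCoeffOn, fourierCoeffOn_eq_integral,
      fourierCoeff_eq_intervalIntegral _ m 0, zero_add, sub_zero]
    rfl
  have hb : ∀ m : ℤ, ‖fourierC T f.1 m‖ ≤ (1 + (m : ℝ) ^ 2)⁻¹ * ‖f‖ := by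
    intro m
    have h1 : ‖(toSeq T f : ℤ → ℂ) m‖ ≤ ‖toSeq T f‖ :=
      lp.norm_apply_le_norm (by norm_num) (toSeq T f) m
    have h2 : (toSeq T f : ℤ → ℂ) m = weightedC T f.1 m := rfl
    have hp : (0 : ℝ) < 1 + (m : ℝ) ^ 2 := by positivity
    rw [h2, weightedC, norm_mul, Complex.norm_real, Real.norm_of_nonneg hp.le] at h1
    rw [← div_eq_inv_mul, le_div_iff₀ hp, mul_comm]
    exact h1
  have hsb : Summable fun m : ℤ => (1 + (m : ℝ) ^ 2)⁻¹ * ‖f‖ :=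
    summable_inv_one_add_sq.mul_right _
  have hsum : Summable fun m : ℤ => ‖fourierC T f.1 m‖ :=
    Summable.of_nonneg_of_le (fun _ => norm_nonneg _) hb hsb
  have hs := has_pointwise_sum_fourier_series_of_summable (f := g)
    (by rw [funext hcoef]; exact hsum.of_norm) (t : AddCircle T)
  have hle : ‖(f.1 t : ℂ)‖ ≤ ∑' m : ℤ, (1 + (m : ℝ) ^ 2)⁻¹ * ‖f‖ := by
    rw [← hgt, ← hs.tsum_eq]
    refine tsum_of_norm_bounded hsb.hasSum fun m => ?_
    rw [hcoef, norm_smul, fourier_apply, Circle.norm_coe, mul_one]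
    exact hb m
  rwa [Complex.norm_real, Real.norm_eq_abs, tsum_mul_right] at hle

/-- The embedding of `H²_e(0,T)` in the continuous functions on the circle. -/
def toCircle : H2e T →L[ℝ] C(AddCircle T, ℝ) :=
  LinearMap.mkContinuous
    { toFun := fun f => ⟨f.2.2.1.lift, f.2.1.quotient_lift _⟩
      map_add' := fun f g => by
        ext x
        induction x using QuotientAddGroup.induction_on
        rfl
      map_smul' := fun c f => by
        ext x
        induction x using QuotientAddGroup.induction_on
        rfl }
    (∑' m : ℤ, (1 + (m : ℝ) ^ 2)⁻¹)
    (fun f => by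
      rw [ContinuousMap.norm_le _ (mul_nonneg (tsum_nonneg fun m => by positivity)
        (norm_nonneg _))]
      intro x
      induction x using QuotientAddGroup.induction_on
      exact abs_apply_le_norm f _)

theorem toCircle_apply (f : H2e T) (t : ℝ) : toCircle f (t : AddCircle T) = f.1 t := rfl

/-- The solution operator as an operator on continuous functions. -/
def greenOp (hres : ∀ n : ℕ, T ≠ 2 * Real.pi * n) :
    C(AddCircle T, ℝ) →L[ℝ] C(AddCircle T, ℝ) :=
  toCircle.comp (solOp hres)

theorem greenOp_apply (hres : ∀ n : ℕ, T ≠ 2 * Real.pi * n) (f : C(AddCircle T, ℝ)) (t : ℝ) :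
    greenOp hres f (t : AddCircle T) = oscSol T (evenPart f) t := rfl

/-- Compactness of the solution operator, by the theorem of Arzelà and Ascoli: the solutions with
`‖f‖ ≤ 1` are uniformly Lipschitz. -/
theorem isCompactOperator_greenOp (hres : ∀ n : ℕ, T ≠ 2 * Real.pi * n) :
    IsCompactOperator (greenOp hres) := by
  have hs := sin_half_ne_zero hT.out hres
  have hcomp := isCompactOperator_iff_isCompact_closure_image_closedBall
    (greenOp hres : C(AddCircle T, ℝ) →ₗ[ℝ] C(AddCircle T, ℝ)) zero_lt_one
  refine hcomp.2 ?_
  set A : Set C(AddCircle T, ℝ) := greenOp hres '' Metric.closedBall 0 1 with hA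
  change IsCompact (closure A)
  let e := ContinuousMap.isometryEquivBoundedOfCompact (AddCircle T) ℝ
  have hlip : ∀ f : C(AddCircle T, ℝ), ‖f‖ ≤ 1 → ∀ s t : ℝ,
      |greenOp hres f (s : AddCircle T) - greenOp hres f (t : AddCircle T)|
        ≤ oscLip T * |s - t| := by
    intro f hf s t
    have hg := continuous_evenPart f
    have := convex_univ.norm_image_sub_le_of_norm_hasDerivWithin_le (x := t) (y := s)
      (f := oscSol T (evenPart f)) (f' := oscSol' T (evenPart f)) (C := oscLip T)
      (fun u _ => (hasDerivAt_oscSol hg u).hasDerivWithinAt)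
      (fun u _ => by
        have := abs_oscSol'_le hT.out hs hg (evenPart_neg f) (periodic_evenPart f)
          (M := 1) (fun t => (abs_evenPart_le f t).trans hf) u
        rwa [mul_one] at this)
      (mem_univ t) (mem_univ s)
    exact this
  have hcpt : IsCompact (closure (e '' A)) := by
    apply BoundedContinuousFunction.arzela_ascoli (Metric.closedBall 0 ‖greenOp hres‖)
      (isCompact_closedBall 0 _)
    · rintro _ x ⟨_, ⟨f, hf, rfl⟩, rfl⟩
      rw [mem_closedBall_zero_iff] at hf ⊢
      calc ‖greenOp hres f x‖ ≤ ‖greenOp hres f‖ := ContinuousMap.norm_coe_le_norm _ x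
        _ ≤ ‖greenOp hres‖ * ‖f‖ := (greenOp hres).le_opNorm f
        _ ≤ ‖greenOp hres‖ := mul_le_of_le_one_right (greenOp hres).opNorm_nonneg hf
    · intro x
      induction x using QuotientAddGroup.induction_on with
      | H t =>
        rw [Metric.equicontinuousAt_iff_right]
        intro ε hε
        rw [QuotientAddGroup.nhds_eq, eventually_map]
        have htend : Tendsto (fun s : ℝ => oscLip T * |t - s|) (𝓝 t) (𝓝 0) := by
          have : Continuous fun s : ℝ => oscLip T * |t - s| := by fun_prop
          simpa using this.tendsto t
        filter_upwards [htend.eventually (gt_mem_nhds hε)] with s hs'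
        rintro ⟨_, ⟨_, ⟨f, hf, rfl⟩, rfl⟩⟩
        rw [mem_closedBall_zero_iff] at hf
        rw [Real.dist_eq]
        exact (hlip f hf t s).trans_lt hs'
  have himg : e.symm '' closure (e '' A) = closure A := by
    have := e.symm.toHomeomorph.image_closure (e '' A)
    rw [IsometryEquiv.coe_toHomeomorph] at this
    rw [this, ← image_comp]
    simp
  rw [← himg]
  exact hcpt.image e.symm.continuous

end

/-! ### Operators on square-summable sequences -/

theorem memLp_of_norm_le {F G : Type*} [NormedAddCommGroup F] [NormedAddCommGroup G]
    {f : ℤ → F} {g : lp (fun _ : ℤ => G) 2} {C : ℝ}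
    (h : ∀ n, ‖f n‖ ≤ C * ‖g n‖) : Memℓp f 2 :=
  ((lp.memℓp g).norm.const_mul C).mono h

theorem norm_le_of_norm_le {F G : Type*} [NormedAddCommGroup F] [NormedAddCommGroup G]
    [NormedSpace ℝ G] {f : lp (fun _ : ℤ => F) 2} {g : lp (fun _ : ℤ => G) 2} {C : ℝ}
    (hC : 0 ≤ C) (h : ∀ n, ‖f n‖ ≤ C * ‖g n‖) : ‖f‖ ≤ C * ‖g‖ := by
  have h1 : ‖f‖ ≤ ‖C • g‖ := by
    apply lp.norm_mono (by norm_num)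
    intro n
    rw [lp.coeFn_smul, Pi.smul_apply, norm_smul, Real.norm_of_nonneg hC]
    exact h n
  rwa [norm_smul, Real.norm_of_nonneg hC] at h1

theorem memLp_shift {F : Type*} [NormedAddCommGroup F] (u : lp (fun _ : ℤ => F) 2) (k : ℤ) :
    Memℓp (fun n => u (n + k)) 2 := by
  have h := (lp.memℓp u).summable (by norm_num)
  apply memℓp_gen
  exact (Equiv.addRight k).summable_iff.2 h

section

variable {F G : Type*} [NormedAddCommGroup F] [NormedSpace ℝ F] [NormedAddCommGroup G]
  [NormedSpace ℝ G]

/-- The operator on `ℓ²` sequences that applies `A n` to the `n`-th entry, for a bounded family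
`A`. -/
def lpMap (A : ℤ → F →L[ℝ] G) {C : ℝ} (hC : 0 ≤ C) (hA : ∀ n, ‖A n‖ ≤ C) :
    lp (fun _ : ℤ => F) 2 →L[ℝ] lp (fun _ : ℤ => G) 2 :=
  LinearMap.mkContinuous
    { toFun := fun u => ⟨fun n => A n (u n),
        memLp_of_norm_le fun n => (A n).le_of_opNorm_le (hA n) (u n)⟩
      map_add' := fun u v => lp.ext (funext fun n => (A n).map_add (u n) (v n))
      map_smul' := fun c u => lp.ext (funext fun n => (A n).map_smul c (u n)) }
    C (fun u => norm_le_of_norm_le hC fun n => (A n).le_of_opNorm_le (hA n) (u n))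

theorem lpMap_apply (A : ℤ → F →L[ℝ] G) {C : ℝ} (hC : 0 ≤ C) (hA : ∀ n, ‖A n‖ ≤ C)
    (u : lp (fun _ : ℤ => F) 2) (n : ℤ) : lpMap A hC hA u n = A n (u n) := rfl

/-- The operator that applies `A` to every entry. -/
def lpConst (A : F →L[ℝ] G) : lp (fun _ : ℤ => F) 2 →L[ℝ] lp (fun _ : ℤ => G) 2 :=
  lpMap (fun _ => A) (norm_nonneg A) fun _ => le_rfl

theorem lpConst_apply (A : F →L[ℝ] G) (u : lp (fun _ : ℤ => F) 2) (n : ℤ) :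
    lpConst A u n = A (u n) := rfl

/-- The shift `(u n) ↦ (u (n + k))`. -/
def lpShift (k : ℤ) : lp (fun _ : ℤ => F) 2 →L[ℝ] lp (fun _ : ℤ => F) 2 :=
  LinearMap.mkContinuous
    { toFun := fun u => ⟨fun n => u (n + k), memLp_shift u k⟩
      map_add' := fun u v => rfl
      map_smul' := fun c u => rfl }
    1 (fun u => by
      rw [one_mul]
      apply lp.norm_le_of_tsum_le (by norm_num) (norm_nonneg u)
      rw [lp.norm_rpow_eq_tsum (by norm_num) u]
      exact ((Equiv.addRight k).tsum_eq fun n => ‖u n‖ ^ (2 : ENNReal).toReal).le)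

/-- The discrete Laplacian. -/
def lpLaplacian : lp (fun _ : ℤ => F) 2 →L[ℝ] lp (fun _ : ℤ => F) 2 :=
  lpShift 1 - (2 : ℝ) • ContinuousLinearMap.id ℝ _ + lpShift (-1)

end

/-! ### Smoothness of superposition operators -/

section

open BoundedContinuousFunction

variable {Ω : Type*} [TopologicalSpace Ω]

theorem exists_bound_comp {f : ℝ → ℝ} (hf : Continuous f) (u : Ω →ᵇ ℝ) :
    ∃ C, ∀ x, ‖f (u x)‖ ≤ C := by
  obtain ⟨C, hC⟩ := (isCompact_Icc (a := -‖u‖) (b := ‖u‖)).exists_bound_of_continuousOn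
    hf.continuousOn
  exact ⟨C, fun x => hC _ (abs_le.1 (u.norm_coe_le_norm x))⟩

/-- The superposition operator `u ↦ f ∘ u` on bounded continuous functions. -/
def superpose (f : ℝ → ℝ) (hf : Continuous f) (u : Ω →ᵇ ℝ) : Ω →ᵇ ℝ :=
  BoundedContinuousFunction.ofNormedAddCommGroup (fun x => f (u x)) (hf.comp u.continuous)
    (exists_bound_comp hf u).choose (exists_bound_comp hf u).choose_spec

theorem hasFDerivAt_superpose {f : ℝ → ℝ} (hf : ContDiff ℝ 2 f) (hc : Continuous f)
    (hc' : Continuous (deriv f)) (u : Ω →ᵇ ℝ) :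
    HasFDerivAt (superpose f hc)
      (ContinuousLinearMap.mul ℝ (Ω →ᵇ ℝ) (superpose (deriv f) hc' u)) u := by
  obtain ⟨C, hC, htay⟩ := exists_taylor_bound hf (‖u‖ + 1)
  rw [hasFDerivAt_iff_isLittleO_nhds_zero]
  have hO : (fun h : Ω →ᵇ ℝ => superpose f hc (u + h) - superpose f hc u -
      ContinuousLinearMap.mul ℝ (Ω →ᵇ ℝ) (superpose (deriv f) hc' u) h) =O[𝓝 0]
      fun h => ‖h‖ ^ 2 := by
    apply Asymptotics.IsBigO.of_bound C
    filter_upwards [Metric.ball_mem_nhds (0 : Ω →ᵇ ℝ) one_pos] with h hh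
    rw [mem_ball_zero_iff] at hh
    rw [norm_pow, norm_norm, BoundedContinuousFunction.norm_le (by positivity)]
    intro x
    have h1 := u.norm_coe_le_norm x
    have h2 := h.norm_coe_le_norm x
    rw [Real.norm_eq_abs] at h1 h2
    have h3 := htay (u x) (abs_le.1 (by linarith)) (u x + h x)
      (abs_le.1 ((abs_add_le _ _).trans (by linarith)))
    rw [add_sub_cancel_left] at h3
    change |f (u x + h x) - f (u x) - deriv f (u x) * h x| ≤ _
    exact h3.trans
      (mul_le_mul_of_nonneg_left (sq_le_sq' (abs_le.1 h2).1 (abs_le.1 h2).2) hC.le)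
  refine hO.trans_isLittleO ?_
  have : (fun h : Ω →ᵇ ℝ => ‖h‖ ^ 2) =o[𝓝 0] fun h => ‖h‖ ^ 1 :=
    (Asymptotics.isLittleO_pow_pow (𝕜 := ℝ) one_lt_two).comp_tendsto tendsto_norm_zero
  simpa using this.trans_isBigO (Asymptotics.isBigO_of_le _ fun h => by simp)

theorem contDiff_superpose {f : ℝ → ℝ} (hf : ContDiff ℝ ∞ f) :
    ContDiff ℝ ∞ (superpose f hf.continuous : (Ω →ᵇ ℝ) → Ω →ᵇ ℝ) := by
  rw [contDiff_infty]
  intro n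
  induction n generalizing f with
  | zero =>
    have hf' : ContDiff ℝ ∞ (deriv f) := (contDiff_infty_iff_deriv.1 hf).2
    have : Continuous (superpose f hf.continuous : (Ω →ᵇ ℝ) → Ω →ᵇ ℝ) :=
      continuous_iff_continuousAt.2 fun u =>
        (hasFDerivAt_superpose (hf.of_le (by norm_cast)) hf.continuous hf'.continuous
          u).continuousAt
    exact contDiff_zero.2 this
  | succ n ih =>
    have hf' : ContDiff ℝ ∞ (deriv f) := (contDiff_infty_iff_deriv.1 hf).2
    rw [Nat.cast_add, Nat.cast_one, contDiff_succ_iff_hasFDerivAt]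
    exact ⟨_, (ContinuousLinearMap.mul ℝ (Ω →ᵇ ℝ)).contDiff.comp (ih hf'),
      hasFDerivAt_superpose (hf.of_le (by norm_cast)) hf.continuous hf'.continuous⟩

end

/-- Hadamard's lemma: a smooth function vanishing at `0` is `x` times a smooth function, namely
`∫₀¹ f'(s x) ds`. -/
theorem exists_smooth_div {f : ℝ → ℝ} (hf : ContDiff ℝ ∞ f) (h0 : f 0 = 0) :
    ∃ g : ℝ → ℝ, ContDiff ℝ ∞ g ∧ ∀ x, f x = g x * x := by
  have key : ∀ n : ℕ, ∀ (f : ℝ → ℝ) (k : ℕ), ContDiff ℝ ∞ f →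
      ContDiff ℝ n fun x => ∫ s in (0 : ℝ)..1, s ^ k * f (s * x) := by
    intro n
    have hder : ∀ (f : ℝ → ℝ) (k : ℕ), ContDiff ℝ ∞ f → ∀ x,
        HasDerivAt (fun x => ∫ s in (0 : ℝ)..1, s ^ k * f (s * x))
          (∫ s in (0 : ℝ)..1, s ^ (k + 1) * deriv f (s * x)) x := by
      intro f k hf x
      have hcf := hf.continuous
      have hcf' : Continuous (deriv f) := (contDiff_infty_iff_deriv.1 hf).2.continuous
      have hd : Differentiable ℝ f := hf.differentiable (by simp)
      obtain ⟨B, hB⟩ := (isCompact_Icc (a := -(|x| + 1))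
        (b := |x| + 1)).exists_bound_of_continuousOn hcf'.continuousOn
      refine (intervalIntegral.hasDerivAt_integral_of_dominated_loc_of_deriv_le
        (F := fun x s => s ^ k * f (s * x)) (F' := fun x s => s ^ (k + 1) * deriv f (s * x))
        (bound := fun _ => B) (Metric.ball_mem_nhds x one_pos) ?_ ?_ ?_ ?_ ?_ ?_).2
      · exact Filter.Eventually.of_forall fun y => Continuous.aestronglyMeasurable (by fun_prop)
      · exact Continuous.intervalIntegrable (by fun_prop) _ _
      · exact Continuous.aestronglyMeasurable (by fun_prop)
      · refine ae_of_all _ fun s hs y hy => ?_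
        rw [uIoc_of_le zero_le_one] at hs
        rw [Metric.mem_ball, Real.dist_eq] at hy
        have hy' : |y| ≤ |x| + 1 := by
          have := abs_sub_abs_le_abs_sub y x
          linarith
        have h1 : |s * y| ≤ |x| + 1 := by
          rw [abs_mul, abs_of_pos hs.1]
          exact (mul_le_of_le_one_left (abs_nonneg y) hs.2).trans hy'
        have h2 := hB (s * y) (abs_le.1 h1)
        rw [norm_mul, norm_pow, Real.norm_of_nonneg hs.1.le]
        exact (mul_le_of_le_one_left (norm_nonneg _) (pow_le_one₀ hs.1.le hs.2)).trans h2
      · exact intervalIntegrable_const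
      · refine ae_of_all _ fun s _ y _ => ?_
        have h1 : HasDerivAt (fun y => f (s * y)) (deriv f (s * y) * s) y :=
          (hd (s * y)).hasDerivAt.comp y (by simpa using (hasDerivAt_id y).const_mul s)
        convert! h1.const_mul (s ^ k) using 1
        ring
    induction n with
    | zero =>
      intro f k hf
      exact contDiff_zero.2 (continuous_iff_continuousAt.2 fun x => (hder f k hf x).continuousAt)
    | succ n ih =>
      intro f k hf
      have hf' : ContDiff ℝ ∞ (deriv f) := (contDiff_infty_iff_deriv.1 hf).2
      rw [Nat.cast_add, Nat.cast_one, contDiff_succ_iff_deriv]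
      refine ⟨fun x => (hder f k hf x).differentiableAt, fun h => by simp at h, ?_⟩
      rw [show deriv (fun x => ∫ s in (0 : ℝ)..1, s ^ k * f (s * x))
        = fun x => ∫ s in (0 : ℝ)..1, s ^ (k + 1) * deriv f (s * x) from
        funext fun x => (hder f k hf x).deriv]
      exact ih (deriv f) (k + 1) hf'
  have hf' : ContDiff ℝ ∞ (deriv f) := (contDiff_infty_iff_deriv.1 hf).2
  have hd : Differentiable ℝ f := hf.differentiable (by simp)
  refine ⟨fun x => ∫ s in (0 : ℝ)..1, s ^ 0 * deriv f (s * x),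
    contDiff_infty.2 fun n => key n (deriv f) 0 hf', fun x => ?_⟩
  have hcf' := hf'.continuous
  have h1 : ∫ s in (0 : ℝ)..1, deriv f (s * x) * x = f (1 * x) - f (0 * x) :=
    intervalIntegral.integral_eq_sub_of_hasDerivAt (f := fun s => f (s * x))
      (fun s _ => (hd (s * x)).hasDerivAt.comp s (by simpa using (hasDerivAt_id s).mul_const x))
      (Continuous.intervalIntegrable (by fun_prop) _ _)
  rw [one_mul, zero_mul, h0, sub_zero, intervalIntegral.integral_mul_const] at h1
  simp only [pow_zero, one_mul]
  exact h1.symm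

/-! ### Superposition on the lattice -/

section

open BoundedContinuousFunction

variable {T : ℝ} [hT : Fact (0 < T)]

/-- The space `ℓ²(ℤ, C(AddCircle T, ℝ))`. -/
abbrev LatticeC (T : ℝ) [Fact (0 < T)] : Type := lp (fun _ : ℤ => C(AddCircle T, ℝ)) 2

/-- A square-summable sequence of functions on the circle as one bounded function on
`ℤ × AddCircle T`. -/
def flatten : LatticeC T →L[ℝ] ((ℤ × AddCircle T) →ᵇ ℝ) :=
  LinearMap.mkContinuous
    { toFun := fun u => BoundedContinuousFunction.ofNormedAddCommGroup
        (fun z : ℤ × AddCircle T => u z.1 z.2)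
        (continuous_prod_of_discrete_left.2 fun n => (u n).continuous) ‖u‖
        (fun z => ((u z.1).norm_coe_le_norm z.2).trans (lp.norm_apply_le_norm (by norm_num) u z.1))
      map_add' := fun u v => rfl
      map_smul' := fun c u => rfl }
    1 (fun u => by
      rw [one_mul]
      exact (BoundedContinuousFunction.norm_le (norm_nonneg u)).2 fun z =>
        ((u z.1).norm_coe_le_norm z.2).trans (lp.norm_apply_le_norm (by norm_num) u z.1))

/-- The restriction of a bounded function on `ℤ × AddCircle T` to `{n} × AddCircle T`. -/
def row (b : (ℤ × AddCircle T) →ᵇ ℝ) (n : ℤ) : C(AddCircle T, ℝ) :=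
  ⟨fun x => b (n, x), b.continuous.comp (by fun_prop)⟩

theorem norm_row_le (b : (ℤ × AddCircle T) →ᵇ ℝ) (n : ℤ) : ‖row b n‖ ≤ ‖b‖ := by
  rw [ContinuousMap.norm_le _ (norm_nonneg b)]
  exact fun x => b.norm_coe_le_norm (n, x)

theorem norm_row_mul_le (b : (ℤ × AddCircle T) →ᵇ ℝ) (u : LatticeC T) (n : ℤ) :
    ‖row b n * u n‖ ≤ ‖b‖ * ‖u n‖ :=
  (norm_mul_le _ _).trans (mul_le_mul_of_nonneg_right (norm_row_le b n) (norm_nonneg _))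

/-- Multiplication of square-summable sequences by bounded functions on `ℤ × AddCircle T`. -/
def latticeMul : ((ℤ × AddCircle T) →ᵇ ℝ) →L[ℝ] LatticeC T →L[ℝ] LatticeC T :=
  LinearMap.mkContinuous₂
    (LinearMap.mk₂ ℝ
      (fun b u => (⟨fun n => row b n * u n, memLp_of_norm_le (norm_row_mul_le b u)⟩ : LatticeC T))
      (fun b c u => lp.ext (funext fun n => add_mul (row b n) (row c n) (u n)))
      (fun c b u => lp.ext (funext fun n => smul_mul_assoc c (row b n) (u n)))
      (fun b u v => lp.ext (funext fun n => mul_add (row b n) (u n) (v n)))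
      (fun c b u => lp.ext (funext fun n => mul_smul_comm c (row b n) (u n))))
    1 (fun b u => by
      rw [one_mul]
      exact norm_le_of_norm_le (norm_nonneg b) (norm_row_mul_le b u))

/-- Evaluation at a site and a point of the circle. -/
def latticeEval (n : ℤ) (x : AddCircle T) : LatticeC T →L[ℝ] ℝ :=
  (ContinuousMap.evalCLM ℝ x).comp (lp.evalCLM ℝ (fun _ : ℤ => C(AddCircle T, ℝ)) 2 n)

theorem latticeEval_apply (n : ℤ) (x : AddCircle T) (u : LatticeC T) :
    latticeEval n x u = u n x := rfl

/-- Superposition with a smooth function `p` vanishing at `0` is a smooth map of `LatticeC T`: by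
Hadamard's lemma it is the product of the sequence with the bounded function `g(u)`, where
`p x = g x * x`. -/
theorem exists_contDiff_lattice_superpose (T : ℝ) [Fact (0 < T)] {p : ℝ → ℝ}
    (hp : ContDiff ℝ ∞ p) (h0 : p 0 = 0) :
    ∃ P : LatticeC T → LatticeC T, ContDiff ℝ ∞ P ∧ (∀ u n x, P u n x = p (u n x)) ∧
      ∀ u h n x, fderiv ℝ P u h n x = deriv p (u n x) * h n x := by
  obtain ⟨g, hg, hpg⟩ := exists_smooth_div hp h0
  set P : LatticeC T → LatticeC T := fun u =>
    latticeMul (superpose g hg.continuous (flatten u)) u with hP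
  have hmul : ContDiff ℝ ∞ fun u : LatticeC T =>
      latticeMul (superpose g hg.continuous (flatten u)) :=
    ContDiff.comp (g := fun b => (latticeMul b : LatticeC T →L[ℝ] LatticeC T)) (by fun_prop)
      ((contDiff_superpose hg).comp (flatten (T := T)).contDiff)
  have hPd : ContDiff ℝ ∞ P := hmul.clm_apply contDiff_id
  have hPa : ∀ u n x, P u n x = p (u n x) := fun u n x => by
    rw [hpg]; rfl
  refine ⟨P, hPd, hPa, fun u h n x => ?_⟩
  have h1 : HasFDerivAt P (fderiv ℝ P u) u := (hPd.differentiable (by simp) u).hasFDerivAt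
  have hline : HasDerivAt (fun s : ℝ => u + s • h) h 0 := by
    simpa using ((hasDerivAt_id (0 : ℝ)).smul_const h).const_add u
  have h1' : HasFDerivAt P (fderiv ℝ P u) (u + (0 : ℝ) • h) := by simpa using h1
  have h2 : HasDerivAt (fun s : ℝ => P (u + s • h)) (fderiv ℝ P u h) 0 :=
    HasFDerivAt.comp_hasDerivAt (F := LatticeC T) (E := LatticeC T) (l := P)
      (f := fun s : ℝ => u + s • h) 0 h1' hline
  have h3 : HasDerivAt (fun s : ℝ => latticeEval n x (P (u + s • h)))
      (latticeEval n x (fderiv ℝ P u h)) 0 :=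
    (latticeEval n x).hasFDerivAt.comp_hasDerivAt 0 h2
  have h4 : HasDerivAt (fun s : ℝ => p (u n x + s * h n x)) (deriv p (u n x) * h n x) 0 := by
    have e1 : HasDerivAt (fun s : ℝ => u n x + s * h n x) (h n x) 0 := by
      simpa using ((hasDerivAt_id (0 : ℝ)).mul_const (h n x)).const_add (u n x)
    have e2 : HasDerivAt p (deriv p (u n x)) (u n x + 0 * h n x) := by
      simpa using (hp.differentiable (by simp) (u n x)).hasDerivAt
    exact HasDerivAt.comp (h₂ := p) 0 e2 e1
  have h5 : (fun s : ℝ => latticeEval n x (P (u + s • h)))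
      = fun s : ℝ => p (u n x + s * h n x) := by
    funext s
    rw [latticeEval_apply, hPa]
    rfl
  rw [h5] at h3
  exact h3.unique h4

end

/-! ### Continuation of nondegenerate solutions -/

/-- The implicit function theorem for a smooth map, with the branch smooth on a whole interval. -/
theorem exists_smooth_branch {W : Type*} [NormedAddCommGroup W] [NormedSpace ℝ W] [CompleteSpace W]
    {F : ℝ × W → W} (hF : ContDiff ℝ ∞ F) {w₀ : W} (h0 : F (0, w₀) = 0)
    (hinv : (fderiv ℝ F (0, w₀) ∘L .inr ℝ ℝ W).IsInvertible) :
    ∃ r > 0, ∃ δ > 0, ∃ ψ : ℝ → W, ψ 0 = w₀ ∧ ContDiffOn ℝ ∞ ψ (Ioo (-r) r) ∧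
      ∀ ε ∈ Ioo (-r) r, F (ε, ψ ε) = 0 ∧ ∀ w, ‖w - w₀‖ < δ → F (ε, w) = 0 → w = ψ ε := by
  have hcF : ∀ z, ContDiffAt ℝ ∞ F z := fun z => hF.contDiffAt
  have hne : (∞ : WithTop ℕ∞) ≠ 0 := by simp
  set ψ := (hcF (0, w₀)).implicitFunction hne hinv with hψ
  have hψ0 : ψ 0 = w₀ := (hcF (0, w₀)).implicitFunction_apply_self hne hinv
  have hψc : ∀ᶠ ε in 𝓝 (0 : ℝ), ContinuousAt ψ ε := by
    have : ContDiffAt ℝ 1 ψ 0 :=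
      ((hcF (0, w₀)).contDiffAt_implicitFunction hne hinv).of_le (by norm_cast)
    filter_upwards [this.eventually (by simp)] with ε hε using hε.continuousAt
  have hψc0 : ContinuousAt ψ 0 := hψc.self_of_nhds
  have hpair : Tendsto (fun ε => (ε, ψ ε)) (𝓝 0) (𝓝 (0, w₀)) := by
    have := continuousAt_id.prodMk hψc0
    rw [ContinuousAt, id, hψ0] at this
    exact this
  have hcfd : Continuous (fderiv ℝ F) := hF.continuous_fderiv hne
  have hinv' : ∀ᶠ z in 𝓝 ((0 : ℝ), w₀), (fderiv ℝ F z ∘L .inr ℝ ℝ W).IsInvertible := by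
    have hc : Continuous fun z => fderiv ℝ F z ∘L .inr ℝ ℝ W := hcfd.clm_comp continuous_const
    obtain ⟨e, he⟩ := hinv
    have := e.nhds
    rw [he] at this
    filter_upwards [hc.continuousAt.eventually this] with z hz
    obtain ⟨e', he'⟩ := hz
    exact ⟨e', he'⟩
  have hroot := (hcF (0, w₀)).eventually_apply_implicitFunction hne hinv
  have huniq := (hcF (0, w₀)).eventually_apply_eq_iff_implicitFunction hne hinv
  rw [h0] at hroot huniq
  have hall : ∀ᶠ ε in 𝓝 (0 : ℝ), F (ε, ψ ε) = 0 ∧ ContinuousAt ψ ε ∧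
      (fderiv ℝ F (ε, ψ ε) ∘L .inr ℝ ℝ W).IsInvertible :=
    hroot.and (hψc.and (hpair.eventually hinv'))
  rw [Metric.eventually_nhds_iff] at huniq
  obtain ⟨δ, hδ, huniq⟩ := huniq
  obtain ⟨r, hr, hball⟩ := Metric.eventually_nhds_iff.1 hall.eventually_nhds
  refine ⟨min r δ, lt_min hr hδ, δ, hδ, ψ, hψ0, ?_, ?_⟩
  · intro ε hε
    have hε' : dist ε 0 < r := by
      rw [Real.dist_eq, sub_zero, abs_lt]
      exact ⟨by linarith [hε.1, min_le_left r δ], by linarith [hε.2, min_le_left r δ]⟩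
    have hn := hball hε'
    obtain ⟨hz, hc, hi⟩ := hn.self_of_nhds
    have hsm := (hcF (ε, ψ ε)).contDiffAt_implicitFunction hne hi
    have hun := (hcF (ε, ψ ε)).eventually_apply_eq_iff_implicitFunction hne hi
    have hcont : Tendsto (fun ε => (ε, ψ ε)) (𝓝 ε) (𝓝 (ε, ψ ε)) := continuousAt_id.prodMk hc
    refine (hsm.congr_of_eventuallyEq ?_).contDiffWithinAt
    filter_upwards [hcont.eventually hun, hn] with ε' h1 h2
    exact (h1.1 (by rw [h2.1, hz])).symm
  · intro ε hε
    have hε' : |ε| < min r δ := abs_lt.2 hε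
    have hε1 : dist ε 0 < r := by
      rw [Real.dist_eq, sub_zero]; exact hε'.trans_le (min_le_left _ _)
    refine ⟨(hball hε1).self_of_nhds.1, fun w hw hFw => ?_⟩
    have hd : dist (ε, w) ((0 : ℝ), w₀) < δ := by
      rw [Prod.dist_eq, Real.dist_eq, sub_zero, dist_eq_norm]
      exact max_lt (hε'.trans_le (min_le_right _ _)) hw
    exact ((huniq hd).1 hFw).symm

/-! ### The linearisation and the fixed point problem -/

section

variable {T : ℝ} [hT : Fact (0 < T)]

/-- Under the nondegeneracy of the period, the linearisation at the periodic orbit is invertible on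
continuous functions: the Fredholm alternative reduces this to the absence of even periodic
solutions of the linearised equation. -/
theorem isUnit_linearization (hres : ∀ n : ℕ, T ≠ 2 * Real.pi * n) {V : ℝ → ℝ}
    (hV : ContDiff ℝ ∞ V) (hVeven : ∀ x, V (-x) = V x) {E a : ℝ} (hE : V 0 < E)
    (ha : IsLeast {x : ℝ | 0 < x ∧ V x = E} a) (hper : T = period V E)
    (hdeg : deriv (period V) E ≠ 0) (φ : H2e T) (hφ : IsOscillatorSolution V φ)
    (hφ0 : φ.1 0 = a) (hφ0' : deriv φ.1 0 = 0) {q : C(AddCircle T, ℝ)}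
    (hq : ∀ t : ℝ, q (t : AddCircle T) = 1 - deriv (deriv V) (φ.1 t)) :
    IsUnit (1 - (greenOp hres).comp (ContinuousLinearMap.mul ℝ C(AddCircle T, ℝ) q)) := by
  have hcomp : IsCompactOperator
      ((greenOp hres).comp (ContinuousLinearMap.mul ℝ C(AddCircle T, ℝ) q)) :=
    (isCompactOperator_greenOp hres).comp_clm (ContinuousLinearMap.mul ℝ C(AddCircle T, ℝ) q)
  rcases hcomp.hasEigenvalue_or_mem_resolventSet one_ne_zero with h | h
  swap
  · rw [spectrum.mem_resolventSet_iff, map_one] at h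
    exact h
  exfalso
  obtain ⟨h, hh, hne⟩ := h.exists_hasEigenvector
  rw [Module.End.mem_eigenspace_iff, one_smul] at hh
  have hh' : greenOp hres (q * h) = h := hh
  have hs := sin_half_ne_zero hT.out hres
  set g := evenPart (q * h) with hg
  have hgc : Continuous g := continuous_evenPart (q * h)
  have hht : ∀ t : ℝ, h (t : AddCircle T) = oscSol T g t := fun t => by
    rw [← greenOp_apply hres (q * h) t, hh']
  have hheven : ∀ t : ℝ, h ((-t : ℝ) : AddCircle T) = h (t : AddCircle T) := fun t => by
    rw [hht, hht, oscSol_neg (evenPart_neg _)]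
  have hφeven : ∀ t, φ.1 (-t) = φ.1 t := φ.2.2.2.1
  have hqh : ∀ t : ℝ, g t = (1 - deriv (deriv V) (φ.1 t)) * oscSol T g t := fun t => by
    rw [hg, evenPart_eq]
    · rw [ContinuousMap.mul_apply, hq, hht]
    · intro t
      rw [ContinuousMap.mul_apply, ContinuousMap.mul_apply, hheven, hq, hq, hφeven]
  have hφd : ∀ t, HasDerivAt φ.1 (deriv φ.1 t) t := fun t => (hφ.1 t).hasDerivAt
  have hφd' : ∀ t, HasDerivAt (deriv φ.1) (-deriv V (φ.1 t)) t := fun t => by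
    rw [← eq_neg_of_add_eq_zero_left (hφ.2 t).2]
    exact (hφ.2 t).1.hasDerivAt
  have hφhalf : deriv φ.1 (T / 2) = 0 := by
    have h1 : deriv φ.1 (-(T / 2)) = -deriv φ.1 (T / 2) := deriv_neg_of_even hφeven _
    have h2 := (hφd (-(T / 2) + T)).comp_add_const (-(T / 2)) T
    rw [show (fun t => φ.1 (t + T)) = φ.1 from funext φ.2.2.1] at h2
    have h3 := h2.unique (hφd _)
    rw [show -(T / 2) + T = T / 2 by ring, h1] at h3
    linarith
  have hw' : ∀ t, HasDerivAt (oscSol' T g) (-deriv (deriv V) (φ.1 t) * oscSol T g t) t := by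
    intro t
    convert! hasDerivAt_oscSol' (T := T) hgc t using 1
    linear_combination -hqh t
  have hzero := linearized_solution_eq_zero hV hVeven hE ha hper hT.out hdeg hφd hφd'
    (hasDerivAt_oscSol (T := T) hgc) hw' hφ0 hφ0' hφhalf
    ⟨_, abs_apply_le_norm φ⟩
    (by
      have := oscSol'_neg (T := T) (evenPart_neg (q * h)) 0
      rw [neg_zero] at this
      rw [hg]
      linarith) (oscSol'_half hs)
  exact hne (circle_ext fun t => by rw [hht, hzero]; rfl)

/-- The correspondence between solutions of the discrete Klein-Gordon equation and fixed points of
the integral operator; `P` is superposition with `x ↦ x - V' x`. -/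
theorem isKGSolution_iff (hres : ∀ n : ℕ, T ≠ 2 * Real.pi * n) {V : ℝ → ℝ}
    {P : LatticeC T → LatticeC T} (hP : ∀ u n x, P u n x = u n x - deriv V (u n x)) (ε : ℝ)
    (v : LatticeH2e T) :
    IsKGSolution V ε (fun n t => (v n).1 t) ↔
      v = lpConst (solOp hres) (P (lpConst toCircle v) + ε • lpLaplacian (lpConst toCircle v)) := by
  set f : LatticeC T := P (lpConst toCircle v) + ε • lpLaplacian (lpConst toCircle v) with hf
  have hft : ∀ n (t : ℝ), f n (t : AddCircle T) = (v n).1 t - deriv V ((v n).1 t) +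
      ε * ((v (n + 1)).1 t - 2 * (v n).1 t + (v (n - 1)).1 t) := by
    intro n t
    have h1 : f n (t : AddCircle T) = P (lpConst toCircle v) n (t : AddCircle T) +
      ε * ((v (n + 1)).1 t - 2 * (v n).1 t + (v (n - 1)).1 t) := rfl
    rw [h1, hP]
    rfl
  have heven : ∀ n (t : ℝ), f n ((-t : ℝ) : AddCircle T) = f n (t : AddCircle T) := by
    intro n t
    rw [hft, hft, (v n).2.2.2.1, (v (n + 1)).2.2.2.1, (v (n - 1)).2.2.2.1]
  have hiff := fun n => eq_solOp_iff hres (heven n) (v n)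
  have hext : v = lpConst (solOp hres) f ↔ ∀ n, v n = solOp hres (f n) :=
    ⟨fun h n => by conv_lhs => rw [h]
                   rfl, fun h => lp.ext (funext h)⟩
  rw [hext]
  refine forall_congr' fun n => ?_
  rw [hiff n]
  refine and_congr Iff.rfl (forall_congr' fun t => and_congr Iff.rfl ?_)
  rw [hft]
  constructor <;> intro h <;> linarith

end

end KG

end

theorem mainTheorem4
    -- the on-site potential: smooth, even, with `V'(u) = u ± u³ + O(u⁵)` as `u → 0`
    (V : ℝ → ℝ) (hV : ContDiff ℝ ∞ V) (hVeven : ∀ x, V (-x) = V x)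
    (s : ℝ) (hs : s = 1 ∨ s = -1)
    (hVexp : (fun x : ℝ => deriv V x - (x + s * x ^ 3)) =O[𝓝 0] (fun x : ℝ => x ^ 5))
    -- the energy level, its turning point and the period
    (E a T : ℝ) [Fact (0 < T)] (hE : V 0 < E)
    (ha : IsLeast {x : ℝ | 0 < x ∧ V x = E} a)
    (hT : T = KG.period V E)
    -- the even oscillator solution at this energy level
    (φ : KG.H2e T) (hφ : KG.IsOscillatorSolution V φ)
    (hφ0 : φ 0 = a) (hφ0' : deriv φ 0 = 0)
    -- non-resonance and non-degeneracy
    (hres : ∀ n : ℕ, T ≠ 2 * Real.pi * n)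
    (hdeg : deriv (KG.period V) E ≠ 0)
    -- excited sites and phases
    (S : Finset ℤ) (σ : ℤ → ℝ) (hσ : ∀ k ∈ S, σ k = 1 ∨ σ k = -1) :
    ∃ ε₀ > (0 : ℝ), ∃ C > (0 : ℝ), ∃ u : ℝ → KG.LatticeH2e T,
      (∀ ε ∈ Ioo (-ε₀) ε₀,
        (KG.IsKGSolution V ε (fun n t => u ε n t) ∧
          ‖u ε - KG.limitingBreather S σ φ‖ ≤ C * |ε|) ∧
        ∀ v : KG.LatticeH2e T,
          KG.IsKGSolution V ε (fun n t => v n t) →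
          ‖v - KG.limitingBreather S σ φ‖ ≤ C * |ε| → v = u ε) ∧
      ContDiffOn ℝ ∞ u (Ioo (-ε₀) ε₀) := by
  have hVd : ContDiff ℝ ∞ (deriv V) := (contDiff_infty_iff_deriv.1 hV).2
  have hVodd := KG.deriv_neg_of_even hVeven
  have hV0 : deriv V 0 = 0 := by
    have := hVodd 0
    rw [neg_zero] at this
    linarith
  have hVdd0 : deriv (deriv V) 0 = 1 := by
    have h1 : HasDerivAt (fun x : ℝ => deriv V x - (x + s * x ^ 3)) 0 0 := by
      have h2 : (fun x : ℝ => deriv V x - (x + s * x ^ 3)) =O[𝓝 0] fun x : ℝ => ‖x - 0‖ ^ 5 := by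
        simpa using hVexp.norm_right
      exact (h2.hasFDerivAt (by norm_num)).hasDerivAt
    have h3 : HasDerivAt (fun x : ℝ => x + s * x ^ 3) 1 0 := by
      have := (hasDerivAt_id (0 : ℝ)).add ((hasDerivAt_pow 3 (0 : ℝ)).const_mul s)
      convert! this using 1
      simp
    have h4 := h1.add h3
    rw [zero_add] at h4
    refine HasDerivAt.deriv (h4.congr_of_eventuallyEq (Eventually.of_forall fun x => ?_))
    simp
  set p : ℝ → ℝ := fun x => x - deriv V x with hp
  have hpd : ContDiff ℝ ∞ p := contDiff_id.sub hVd
  have hp' : ∀ x, deriv p x = 1 - deriv (deriv V) x := fun x =>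
    ((hasDerivAt_id x).sub (hVd.differentiable (by simp) x).hasDerivAt).deriv
  have hp'even : ∀ x, deriv p (-x) = deriv p x := fun x => by
    rw [hp', hp']
    have h := deriv_comp_neg (deriv V) x
    rw [funext hVodd, deriv.fun_neg, neg_inj] at h
    rw [h]
  obtain ⟨P, hPd, hPa, hP'⟩ := KG.exists_contDiff_lattice_superpose T hpd (by simp [hp, hV0])
  have hiff := KG.isKGSolution_iff hres hPa
  set u₀ : KG.LatticeH2e T := KG.limitingBreather S σ φ with hu₀
  have hu₀n : ∀ n, u₀ n = if n ∈ S then σ n • φ else 0 := by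
    intro n
    rw [hu₀, KG.limitingBreather, lp.coeFn_sum, Finset.sum_apply]
    simp only [lp.coeFn_single, Finset.sum_pi_single]
  set J := KG.lpConst (KG.toCircle (T := T)) with hJ
  set K := KG.lpConst (KG.solOp hres) with hK
  set A := KG.lpConst (KG.greenOp hres) with hA
  have hJK : ∀ w, J (K w) = A w := fun w => rfl
  set w₀ : KG.LatticeC T := J u₀ with hw₀
  have hw₀n : ∀ n (t : ℝ), w₀ n (t : AddCircle T) = if n ∈ S then σ n * φ.1 t else 0 := by
    intro n t
    have h1 : w₀ n (t : AddCircle T) = (u₀ n).1 t := rfl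
    rw [h1, hu₀n]
    split_ifs <;> rfl
  -- The limiting configuration solves the uncoupled equation.
  have hsol₀ : KG.IsKGSolution V 0 (fun n t => (u₀ n).1 t) := by
    intro n
    have hfun : (u₀ n).1 = fun t => (if n ∈ S then σ n else 0) * φ.1 t := by
      rw [hu₀n]
      split_ifs
      · rfl
      · funext t
        rw [zero_mul]
        rfl
    change Differentiable ℝ (u₀ n).1 ∧ ∀ t : ℝ, DifferentiableAt ℝ (deriv (u₀ n).1) t ∧
      deriv (deriv (u₀ n).1) t + deriv V ((u₀ n).1 t) = 0 * _
    rw [hfun]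
    have hd1 : deriv (fun t => (if n ∈ S then σ n else 0) * φ.1 t)
        = fun t => (if n ∈ S then σ n else 0) * deriv φ.1 t :=
      funext fun t => deriv_const_mul _ (hφ.1 t)
    refine ⟨hφ.1.const_mul _, fun t => ?_⟩
    rw [hd1, deriv_const_mul _ (hφ.2 t).1]
    refine ⟨(hφ.2 t).1.const_mul _, ?_⟩
    have h1 := (hφ.2 t).2
    rw [zero_mul]
    split_ifs with hn
    · rcases hσ n hn with h | h
      · rw [h]
        simpa using h1
      · simp only [h, neg_one_mul, hVodd]
        linarith
    · simp [hV0]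
  set F : ℝ × KG.LatticeC T → KG.LatticeC T :=
    fun z => z.2 - A (P z.2 + z.1 • KG.lpLaplacian z.2) with hF
  have hFd : ContDiff ℝ ∞ F := by
    have h1 : ContDiff ℝ ∞ fun z : ℝ × KG.LatticeC T => P z.2 := hPd.comp contDiff_snd
    have h2 : ContDiff ℝ ∞ fun z : ℝ × KG.LatticeC T => z.1 • KG.lpLaplacian z.2 := by fun_prop
    exact contDiff_snd.sub (A.contDiff.comp (h1.add h2))
  have hF0 : F (0, w₀) = 0 := by
    have h1 := (hiff 0 u₀).1 hsol₀
    have h2 : w₀ = A (P w₀ + (0 : ℝ) • KG.lpLaplacian w₀) := by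
      rw [← hJK]
      exact congrArg J h1
    exact sub_eq_zero.2 h2
  -- The linearisation acts site by site: by an invertible operator on `S`, trivially elsewhere.
  have hqc : Continuous fun x : AddCircle T => deriv p (KG.toCircle φ x) :=
    ((contDiff_infty_iff_deriv.1 hpd).2.continuous).comp (KG.toCircle φ).continuous
  obtain ⟨L, hL⟩ := KG.isUnit_linearization hres hV hVeven hE ha hT hdeg φ hφ hφ0 hφ0'
    (q := ⟨_, hqc⟩) (fun t => hp' _)
  have hinv : (fderiv ℝ F (0, w₀) ∘L .inr ℝ ℝ (KG.LatticeC T)).IsInvertible := by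
    have hfd : ∀ h, (fderiv ℝ F (0, w₀) ∘L .inr ℝ ℝ (KG.LatticeC T)) h
        = h - A (fderiv ℝ P w₀ h) := by
      have h1 : HasFDerivAt F (fderiv ℝ F (0, w₀)) (0, w₀) :=
        (hFd.differentiable (by simp) _).hasFDerivAt
      have h2 : HasFDerivAt (fun w : KG.LatticeC T => F (0, w))
          (fderiv ℝ F (0, w₀) ∘L .inr ℝ ℝ (KG.LatticeC T)) w₀ :=
        HasFDerivAt.comp (g := F) w₀ h1 (hasFDerivAt_prodMk_right 0 w₀)
      have h3 : HasFDerivAt (fun w : KG.LatticeC T => w - A (P w))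
          (ContinuousLinearMap.id ℝ _ - A ∘L fderiv ℝ P w₀) w₀ :=
        (hasFDerivAt_id w₀).sub
          (A.hasFDerivAt.comp w₀ (hPd.differentiable (by simp) w₀).hasFDerivAt)
      have h4 : (fun w : KG.LatticeC T => F (0, w)) = fun w => w - A (P w) := by
        funext w
        simp [hF]
      rw [h4] at h2
      intro h
      rw [h2.unique h3]
      rfl
    let B : ℤ → C(AddCircle T, ℝ) →L[ℝ] C(AddCircle T, ℝ) :=
      fun n => if n ∈ S then (↑L⁻¹ : C(AddCircle T, ℝ) →L[ℝ] C(AddCircle T, ℝ)) else 1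
    let D : ℤ → C(AddCircle T, ℝ) →L[ℝ] C(AddCircle T, ℝ) :=
      fun n => if n ∈ S then (↑L : C(AddCircle T, ℝ) →L[ℝ] C(AddCircle T, ℝ)) else 1
    have hBb : ∀ n, ‖B n‖ ≤ max ‖(↑L⁻¹ : C(AddCircle T, ℝ) →L[ℝ] C(AddCircle T, ℝ))‖
        ‖(1 : C(AddCircle T, ℝ) →L[ℝ] C(AddCircle T, ℝ))‖ := by
      intro n
      by_cases hn : n ∈ S
      · simp [B, hn]
      · simp [B, hn]
    have hBD : ∀ n x, B n (D n x) = x := by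
      intro n x
      by_cases hn : n ∈ S
      · simp only [B, D, hn, if_true]
        rw [← mul_apply_eq_comp, Units.inv_mul]
        rfl
      · simp [B, D, hn]
    have hDB : ∀ n x, D n (B n x) = x := by
      intro n x
      by_cases hn : n ∈ S
      · simp only [B, D, hn, if_true]
        rw [← mul_apply_eq_comp, Units.mul_inv]
        rfl
      · simp [B, D, hn]
    have hfdn : ∀ h n, (fderiv ℝ F (0, w₀) ∘L .inr ℝ ℝ (KG.LatticeC T)) h n = D n (h n) := by
      intro h n
      rw [hfd, lp.coeFn_sub, Pi.sub_apply, hA, KG.lpConst_apply]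
      by_cases hn : n ∈ S
      · have h1 : fderiv ℝ P w₀ h n = (⟨_, hqc⟩ : C(AddCircle T, ℝ)) * h n := by
          refine KG.circle_ext fun t => ?_
          rw [hP', hw₀n, if_pos hn]
          change _ = deriv p (φ.1 t) * h n t
          rcases hσ n hn with h2 | h2
          · rw [h2, one_mul]
          · rw [h2, neg_one_mul, hp'even]
        rw [h1]
        simp only [D, hn, if_true, hL]
        rfl
      · have h1 : fderiv ℝ P w₀ h n = 0 := by
          refine KG.circle_ext fun t => ?_
          rw [hP', hw₀n, if_neg hn, hp', hVdd0, sub_self, zero_mul]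
          rfl
        rw [h1, map_zero, sub_zero]
        simp [D, hn]
    refine ⟨ContinuousLinearEquiv.equivOfInverse
      (fderiv ℝ F (0, w₀) ∘L .inr ℝ ℝ (KG.LatticeC T))
      (KG.lpMap B (le_max_of_le_left (norm_nonneg _)) hBb) (fun h => ?_) (fun h => ?_), ?_⟩
    · refine lp.ext (funext fun n => ?_)
      rw [KG.lpMap_apply, hfdn, hBD]
    · refine lp.ext (funext fun n => ?_)
      rw [hfdn, KG.lpMap_apply, hDB]
    · ext1 h
      rfl
  obtain ⟨r, hr, δ, hδ, ψ, hψ0, hψd, hψ⟩ := KG.exists_smooth_branch hFd hF0 hinv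
  set u : ℝ → KG.LatticeH2e T := fun ε => K (P (ψ ε) + ε • KG.lpLaplacian (ψ ε)) with hu
  have hud : ContDiffOn ℝ ∞ u (Ioo (-r) r) := by
    have h1 : ContDiffOn ℝ ∞ (fun ε => P (ψ ε)) (Ioo (-r) r) := hPd.comp_contDiffOn hψd
    have hLap : ContDiff ℝ ∞ fun w : KG.LatticeC T => KG.lpLaplacian w := by fun_prop
    have h2 : ContDiffOn ℝ ∞ (fun ε => ε • KG.lpLaplacian (ψ ε)) (Ioo (-r) r) :=
      contDiffOn_id.smul (hLap.comp_contDiffOn hψd)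
    exact K.contDiff.comp_contDiffOn (h1.add h2)
  have hJu : ∀ ε ∈ Ioo (-r) r, J (u ε) = ψ ε := fun ε hε =>
    (sub_eq_zero.1 (hψ ε hε).1).symm
  have hu0 : u 0 = u₀ := by
    have h1 := (hiff 0 u₀).1 hsol₀
    rw [hu]
    simp only [hψ0]
    exact h1.symm
  -- The branch is Lipschitz at `0`.
  have hlip : (fun ε => u ε - u₀) =O[𝓝 0] fun ε : ℝ => ε := by
    have h1 : DifferentiableAt ℝ u 0 :=
      (hud.contDiffAt (Ioo_mem_nhds (by linarith) hr)).differentiableAt (by simp)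
    simpa [hu0] using h1.isBigO_sub
  obtain ⟨C, hC, hCb⟩ := hlip.exists_pos
  obtain ⟨ρ, hρ, hCb⟩ := Metric.eventually_nhds_iff.1 hCb.bound
  have hden : 0 < C * (‖J‖ + 1) := mul_pos hC (by linarith [J.opNorm_nonneg])
  -- The last bound on `ε` makes `‖v - u₀‖ ≤ C |ε|` imply `‖J v - w₀‖ < δ`, so that `J v` lies in the
  -- ball on which `ψ ε` is the only zero of `F (ε, ·)`.
  refine ⟨min (min r ρ) (δ / (C * (‖J‖ + 1))), lt_min (lt_min hr hρ) (div_pos hδ hden), C, hC, u,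
    fun ε hε => ?_, ?_⟩
  · have hε' : |ε| < min (min r ρ) (δ / (C * (‖J‖ + 1))) := abs_lt.2 hε
    have hεr : ε ∈ Ioo (-r) r :=
      abs_lt.1 (hε'.trans_le ((min_le_left _ _).trans (min_le_left _ _)))
    have hερ : |ε| < ρ := hε'.trans_le ((min_le_left _ _).trans (min_le_right _ _))
    have hεδ : |ε| < δ / (C * (‖J‖ + 1)) := hε'.trans_le (min_le_right _ _)
    refine ⟨⟨(hiff ε (u ε)).2 ?_, ?_⟩, fun v hv hvb => ?_⟩
    · change u ε = K (P (J (u ε)) + ε • KG.lpLaplacian (J (u ε)))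
      rw [hJu ε hεr]
    · have := hCb (y := ε) (by rwa [Real.dist_eq, sub_zero])
      rwa [Real.norm_eq_abs] at this
    · have hvK : v = K (P (J v) + ε • KG.lpLaplacian (J v)) := (hiff ε v).1 hv
      have hFv : F (ε, J v) = 0 := by
        refine sub_eq_zero.2 ?_
        change J v = A (P (J v) + ε • KG.lpLaplacian (J v))
        rw [← hJK, ← hvK]
      have hclose : ‖J v - w₀‖ < δ := by
        rw [hw₀, ← map_sub]
        rw [lt_div_iff₀ hden] at hεδ
        calc ‖J (v - u₀)‖ ≤ ‖J‖ * ‖v - u₀‖ := J.le_opNorm _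
          _ ≤ ‖J‖ * (C * |ε|) := mul_le_mul_of_nonneg_left hvb J.opNorm_nonneg
          _ ≤ |ε| * (C * (‖J‖ + 1)) := by nlinarith [mul_nonneg hC.le (abs_nonneg ε)]
          _ < δ := hεδ
      have hJv := (hψ ε hεr).2 (J v) hclose hFv
      rw [hvK, hJv]
  · refine hud.mono fun ε hε => ?_
    have hε' : |ε| < min (min r ρ) (δ / (C * (‖J‖ + 1))) := abs_lt.2 hε
    exact abs_lt.1 (hε'.trans_le ((min_le_left _ _).trans (min_le_left _ _)))
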